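/- Let $m\in\mathbb N$, let $T_i<T_{i+1}$ be consecutive maturities, put $\sigma^2=T_{i+1}-T_i$, let $\rho(x)=\frac1{\sqrt{2\pi\sigma^2}}e^{-x^2/(2\sigma^2)}$ be the density of $N(0,\sigma^2)$, and write $(K\star f)(z)=\int_{\mathbb R}f(z-x)\rho(x)\,dx$. A function is called piecewise polynomial on an interval $J$ if $J$ can be cut at finitely many points (knots) so that the function is a polynomial on each remaining piece. Let $F:\mathbb R\to\mathbb R$ (the current iterate of the Bass local volatility fixed-point scheme) be piecewise polynomial and of class $C^m$ on $\mathbb R$, and let $F_{\mu_{i+1}}^{-1}$ (the inverse of the marginal distribution function at $T_{i+1}$, as used in the scheme) be piecewise polynomial and of class $C^m$ on $J$, where either $J=\mathbb R$ (the inverse is a spline extrapolated to the whole line), or $J=(0,1)$ (the inverse is given on its natural domain) and $F$ is the cumulative distribution function of a probability measure on $\mathbb R$. For $m\ge 0$ let $$\mathscr H_m=\Big\{f\in L^2_\rho(\mathbb R)\ :\ \text{the weak derivatives } f^{(\tau)},\ 1\le\tau\le m,\ \text{exist and lie in } L^2_\rho(\mathbb R)\Big\},$$ and let $Q_n(f)=\sum_{k=1}^n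 w_k f(\sigma x_k)$ be the $n$-point Gauss–Hermite quadrature rule for the weight $\rho$, where $x_1,\dots,x_n$ are the zeros of the probabilists' Hermite polynomial $He_n$ and $w_k$ is the integral against $N(0,1)$ of the $k$-th Lagrange basis polynomial on these nodes. Consider the two integrals in $$\int_{\mathbb R}\rho(y)\,F_{\mu_{i+1}}^{-1}\Big(\int_{\mathbb R}F(w-y-x)\rho(x)\,dx\Big)\,dy .$$ Then: 1. For all $w,y\in\mathbb R$ the inner integrand $x\mapsto F(w-y-x)$ lies in $\mathscr H_m$, and $$\Big|Q_n\big(F(w-y-\cdot)\big)-\int_{\mathbb R}F(w-y-x)\rho(x)\,dx\Big|=O(n^{-m/2})\quad(n\to\infty).$$ 2. $(K\star F)(z)\in J$ for every $z\in\mathbb R$; and for every $w\in\mathbb R$ the outer integrand $y\mapsto F_{\mu_{i+1}}^{-1}\big((K\star F)(w-y)\big)$ lies in $\mathscr H_m$, and $$\Big|Q_n\big(F_{\mu_{i+1}}^{-1}((K\star F)(w-\cdot))\big)-\int_{\mathbb R}F_{\mu_{i+1}}^{-1}\big((K\star F)(w-y)\big)\rho(y)\,dy\Big|=O(n^{-m/2})\quad(n\to\infty).$$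 The implied constants may depend on $m,\sigma,F,F_{\mu_{i+1}}^{-1},w,y$, but not on $n$. -/

import Mathlib

open MeasureTheory ProbabilityTheory Asymptotics
open scoped NNReal ENNReal ContDiff

noncomputable section

/-- `f` is piecewise polynomial on `J`: there is a finite set of knots such that `f` agrees with
one polynomial on every interval (of any kind) contained in `J` and free of knots. -/
def IsPiecewisePolynomialOn (f : ℝ → ℝ) (J : Set ℝ) : Prop :=
  ∃ knots : Finset ℝ, ∀ I : Set ℝ, I.OrdConnected → I ⊆ J → Disjoint I (knots : Set ℝ) →
    ∃ p : Polynomial ℝ, ∀ x ∈ I, f x = p.eval x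

/-- `f` is piecewise polynomial and of class `C^m` on `J`. -/
def IsSplineOn (m : ℕ) (f : ℝ → ℝ) (J : Set ℝ) : Prop :=
  ContDiffOn ℝ m f J ∧ IsPiecewisePolynomialOn f J

/-- `F` is the cumulative distribution function of a probability measure on the real line. -/
def IsCDF (F : ℝ → ℝ) : Prop :=
  ∃ μ : Measure ℝ, IsProbabilityMeasure μ ∧ ∀ x, F x = cdf μ x

/-- Convolution with the heat kernel at time `v`, that is, with the density `ρ` of `N(0, v)`:
`(K_v ⋆ f)(z) = ∫ f(z - x) ρ(x) dx`. -/
def heatConv (v : ℝ≥0) (f : ℝ → ℝ) (z : ℝ) : ℝ :=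
  ∫ x : ℝ, f (z - x) * gaussianPDFReal 0 v x

/-- `g` is the weak derivative of order `k` of `f` on the real line. -/
def HasWeakDeriv (k : ℕ) (f g : ℝ → ℝ) : Prop :=
  LocallyIntegrable f ∧ LocallyIntegrable g ∧
    ∀ φ : ℝ → ℝ, ContDiff ℝ ∞ φ → HasCompactSupport φ →
      ∫ x, f x * iteratedDeriv k φ x = (-1) ^ k * ∫ x, g x * φ x

/-- The Gaussian-weighted Sobolev space of order `m` with weight the density of `N(0, v)`:
`f` is in `L²(N(0, v))` and has weak derivatives of orders `1, …, m`, all in `L²(N(0, v))`. -/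
def MemGaussianSobolev (m : ℕ) (v : ℝ≥0) (f : ℝ → ℝ) : Prop :=
  MemLp f 2 (gaussianReal 0 v) ∧
    ∀ k : ℕ, 1 ≤ k → k ≤ m → ∃ g : ℝ → ℝ, HasWeakDeriv k f g ∧ MemLp g 2 (gaussianReal 0 v)

/-- The real zeros of the probabilists' Hermite polynomial of degree `n`. -/
def hermiteNodes (n : ℕ) : Finset ℝ :=
  ((Polynomial.hermite n).map (Int.castRingHom ℝ)).roots.toFinset

/-- The weight of the node `x` in the `n`-point Gauss–Hermite rule for `N(0, 1)`: the Gaussian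
integral of the Lagrange basis polynomial of `x` on the `n` nodes. -/
def gaussHermiteWeight (n : ℕ) (x : ℝ) : ℝ :=
  ∫ t, (Lagrange.basis (hermiteNodes n) id x).eval t ∂(gaussianReal 0 1)

/-- The `n`-point Gauss–Hermite quadrature of `f` for the weight `N(0, v)`: the rule for
`N(0, 1)` with its nodes scaled by the standard deviation `√v`. -/
def gaussHermite (n : ℕ) (v : ℝ≥0) (f : ℝ → ℝ) : ℝ :=
  ∑ x ∈ hermiteNodes n, gaussHermiteWeight n x * f (√(v : ℝ) * x)

end

/-! Call a function tempered of order `m` if it and its first `m` derivatives are Lipschitz with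
polynomially growing local constants. Both integrands are tempered, and everything else follows from
that. A `C^m` piecewise polynomial is tempered on an open interval (`IsSplineOn.temperedOn`): its
`m`-th derivative is continuous and piecewise polynomial, hence Lipschitz across the knots. The
class is stable under products, composition and Gaussian convolution. In the case `J = (0,1)`,
averaging a CDF against a positive density gives values strictly between 0 and 1, so the composition
makes sense.

For the quadrature rate, expand a tempered `g` in orthonormal Hermite polynomials `h_j`. Integrating
by parts `m` times, and once more using only the Lipschitz bound, gives `∑ j^(m+1) a_j² < ∞`.
Cauchy–Schwarz then gives `∑_{j ≥ n} |a_j| = O(n^(-m/2))` for `m ≥ 1`. The additional Lipschitz step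
matters: square integrability of `g^(m)` alone would lose a factor `√n` in this argument.

The rule integrates degrees below `2n` exactly, so the error is `∑_{j ≥ 2n} a_j Q_n(h_j)`, and it
remains to bound `Q_n(h_j)` uniformly. Nodes satisfy `x² < 4n ≤ 2j`, a range where a Cramér-type
bound `|h_j(x)| ≤ 2 exp(x²/4)` holds (`abs_hermiteN_le`). The weights are nonnegative and the rule
underestimates every moment, so `Q_n(exp(x²/4)) ≤ ∫ exp(x²/4) < ∞` (`gaussHermite_exp_le`). Since
nodes are single points, the Hermite series must converge pointwise and not only in `L²`
(`tendsto_hermite_sum`). -/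

/-- `f` is bounded by a multiple of a power of `1 + |x|`. -/
def PolyGrowth (f : ℝ → ℝ) : Prop :=
  ∃ C : ℝ, ∃ N : ℕ, 0 ≤ C ∧ ∀ x, |f x| ≤ C * (1 + |x|) ^ N

namespace PolyGrowth

theorem const (c : ℝ) : PolyGrowth fun _ => c := ⟨|c|, 0, abs_nonneg c, fun x => by simp⟩

theorem id : PolyGrowth fun x => x := ⟨1, 1, zero_le_one, fun x => by simp⟩

theorem mul {f g : ℝ → ℝ} (hf : PolyGrowth f) (hg : PolyGrowth g) :
    PolyGrowth fun x => f x * g x := by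
  obtain ⟨C, N, hC, h⟩ := hf
  obtain ⟨D, M, hD, k⟩ := hg
  refine ⟨C * D, N + M, by positivity, fun x => ?_⟩
  calc |f x * g x| = |f x| * |g x| := abs_mul _ _
    _ ≤ (C * (1 + |x|) ^ N) * (D * (1 + |x|) ^ M) :=
      mul_le_mul (h x) (k x) (abs_nonneg _) (by positivity)
    _ = _ := by ring

theorem add {f g : ℝ → ℝ} (hf : PolyGrowth f) (hg : PolyGrowth g) :
    PolyGrowth fun x => f x + g x := by
  obtain ⟨C, N, hC, h⟩ := hf
  obtain ⟨D, M, hD, k⟩ := hg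
  refine ⟨C + D, N + M, by positivity, fun x => ?_⟩
  have h1 : (1 : ℝ) ≤ 1 + |x| := by simp
  have h2 : (1 + |x|) ^ N ≤ (1 + |x|) ^ (N + M) := pow_le_pow_right₀ h1 (by omega)
  have h3 : (1 + |x|) ^ M ≤ (1 + |x|) ^ (N + M) := pow_le_pow_right₀ h1 (by omega)
  calc |f x + g x| ≤ |f x| + |g x| := abs_add_le _ _
    _ ≤ C * (1 + |x|) ^ N + D * (1 + |x|) ^ M := add_le_add (h x) (k x)
    _ ≤ C * (1 + |x|) ^ (N + M) + D * (1 + |x|) ^ (N + M) := by gcongr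
    _ = _ := by ring

theorem pow {f : ℝ → ℝ} (hf : PolyGrowth f) (n : ℕ) : PolyGrowth fun x => f x ^ n := by
  induction n with
  | zero => simpa using const 1
  | succ n ih => simpa [pow_succ] using ih.mul hf

theorem abs {f : ℝ → ℝ} (hf : PolyGrowth f) : PolyGrowth fun x => |f x| := by
  obtain ⟨C, N, hC, h⟩ := hf
  exact ⟨C, N, hC, fun x => by simpa using h x⟩

theorem eval (p : Polynomial ℝ) : PolyGrowth fun x => p.eval x := by
  induction p using Polynomial.induction_on' with
  | add p q hp hq => simpa using hp.add hq
  | monomial n a => simpa using (const a).mul (id.pow n)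

end PolyGrowth

theorem integrable_one_add_abs_pow (v : ℝ≥0) (N : ℕ) :
    Integrable (fun x : ℝ => (1 + |x|) ^ N) (gaussianReal 0 v) := by
  rcases Nat.eq_zero_or_pos N with rfl | hN
  · simp
  have h : MemLp (fun x : ℝ => 1 + |x|) (N : ℝ≥0∞) (gaussianReal 0 v) := by
    have h1 : MemLp (fun x : ℝ => x) (N : ℝ≥0∞) (gaussianReal 0 v) :=
      memLp_id_gaussianReal' _ (by simp)
    exact (memLp_const (1 : ℝ)).add h1.abs
  have h2 := h.integrable_norm_pow (by omega)
  refine h2.congr (ae_of_all _ fun x => ?_)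
  simp only [Real.norm_eq_abs]
  rw [abs_of_nonneg (by positivity)]

namespace PolyGrowth

theorem integrable {f : ℝ → ℝ} (hf : PolyGrowth f) (v : ℝ≥0) (hm : Measurable f) :
    Integrable f (gaussianReal 0 v) := by
  obtain ⟨C, N, hC, h⟩ := hf
  refine ((integrable_one_add_abs_pow v N).const_mul C).mono' hm.aestronglyMeasurable
    (ae_of_all _ fun x => ?_)
  simpa using h x

theorem memLp {f : ℝ → ℝ} (hf : PolyGrowth f) (v : ℝ≥0) (hm : Measurable f) :
    MemLp f 2 (gaussianReal 0 v) :=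
  (memLp_two_iff_integrable_sq hm.aestronglyMeasurable).2
    ((hf.pow 2).integrable v (hm.pow_const 2))

end PolyGrowth

/-! ### Gaussian integrals and integration by parts -/

theorem integrable_gaussianReal_iff {v : ℝ≥0} (hv : v ≠ 0) (f : ℝ → ℝ) :
    Integrable f (gaussianReal 0 v) ↔ Integrable (fun x => f x * gaussianPDFReal 0 v x) := by
  rw [gaussianReal_of_var_ne_zero _ hv]
  rw [integrable_withDensity_iff_integrable_smul' (measurable_gaussianPDF 0 v)
    (ae_of_all _ fun x => gaussianPDF_lt_top)]
  simp only [toReal_gaussianPDF, smul_eq_mul, mul_comm]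

theorem integral_gaussianReal_eq {v : ℝ≥0} (hv : v ≠ 0) (f : ℝ → ℝ) :
    ∫ x, f x ∂(gaussianReal 0 v) = ∫ x, f x * gaussianPDFReal 0 v x := by
  rw [integral_gaussianReal_eq_integral_smul hv]
  simp only [smul_eq_mul, mul_comm]

theorem hasDerivAt_gaussianPDFReal_one (x : ℝ) :
    HasDerivAt (gaussianPDFReal 0 1) (-x * gaussianPDFReal 0 1 x) x := by
  have h : HasDerivAt (fun x : ℝ => -(x - 0) ^ 2 / (2 * ((1 : ℝ≥0) : ℝ))) (-x) x := by
    have := ((hasDerivAt_pow 2 x).neg).div_const 2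
    convert! this using 1
    · ext y; simp
    · simp; ring
  have := (h.exp).const_mul (√(2 * Real.pi * ((1 : ℝ≥0) : ℝ)))⁻¹
  convert! this using 1
  simp only [gaussianPDFReal]
  ring

/-- Stein's identity: `(f ρ)' = (f' - x f) ρ`, and an integrable derivative of an integrable
function has integral zero. -/
theorem gaussian_integral_deriv {f f' : ℝ → ℝ} (hf : PolyGrowth f) (hf' : PolyGrowth f')
    (hm : Measurable f') (hd : ∀ x, HasDerivAt f (f' x) x) :
    ∫ x, f' x ∂(gaussianReal 0 1) = ∫ x, x * f x ∂(gaussianReal 0 1) := by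
  have hc : Measurable f := (continuous_iff_continuousAt.2 fun x => (hd x).continuousAt).measurable
  have i1 := hf'.integrable 1 hm
  have i2 := (PolyGrowth.id.mul hf).integrable 1 (measurable_id.mul hc)
  have i3 := (integrable_gaussianReal_iff one_ne_zero _).1 (hf.integrable 1 hc)
  have i4 := (integrable_gaussianReal_iff one_ne_zero _).1 (i1.sub i2)
  rw [← sub_eq_zero, ← integral_sub i1 i2, integral_gaussianReal_eq one_ne_zero]
  refine integral_eq_zero_of_hasDerivAt_of_integrable (f := fun x => f x * gaussianPDFReal 0 1 x)
    (fun x => ?_) i4 i3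
  convert! (hd x).mul (hasDerivAt_gaussianPDFReal_one x) using 1
  ring

/-! ### Hermite polynomials: recurrences and orthogonality -/

open Polynomial in
/-- The probabilists' Hermite polynomials with real coefficients. -/
noncomputable def hermiteR (n : ℕ) : ℝ[X] := (hermite n).map (Int.castRingHom ℝ)

section Hermite
open Polynomial

theorem hermiteR_zero : hermiteR 0 = 1 := by simp [hermiteR]

theorem hermiteR_one : hermiteR 1 = X := by simp [hermiteR]

theorem hermiteR_succ (n : ℕ) : hermiteR (n + 1) = X * hermiteR n - derivative (hermiteR n) := by
  simp [hermiteR, hermite_succ, derivative_map]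

theorem monic_hermiteR (n : ℕ) : (hermiteR n).Monic := (hermite_monic n).map _

theorem natDegree_hermiteR (n : ℕ) : (hermiteR n).natDegree = n := by
  rw [hermiteR, (hermite_monic n).natDegree_map, natDegree_hermite]

theorem derivative_hermiteR_succ (n : ℕ) :
    derivative (hermiteR (n + 1)) = C ((n : ℝ) + 1) * hermiteR n := by
  induction n with
  | zero => simp [hermiteR_one, hermiteR_zero]
  | succ n ih =>
    rw [hermiteR_succ (n + 1), derivative_sub, derivative_mul, ih, derivative_mul, hermiteR_succ n]
    simp
    ring

theorem hermiteR_succ_succ (n : ℕ) :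
    hermiteR (n + 2) = X * hermiteR (n + 1) - C ((n : ℝ) + 1) * hermiteR n := by
  rw [hermiteR_succ (n + 1), derivative_hermiteR_succ]

theorem X_pow_succ_mul_hermiteR_succ (k j : ℕ) : (X ^ (k + 1) * hermiteR (j + 1) : ℝ[X])
    = X ^ k * hermiteR (j + 2) + C ((j : ℝ) + 1) * (X ^ k * hermiteR j) := by
  rw [hermiteR_succ_succ]; ring

theorem eval_hermiteR_succ_succ (n : ℕ) (x : ℝ) :
    (hermiteR (n + 2)).eval x
      = x * (hermiteR (n + 1)).eval x - ((n : ℝ) + 1) * (hermiteR n).eval x := by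
  rw [hermiteR_succ_succ]; simp

/-- Since `He_{n+1} = x He_n - He_n'`, this is Stein's identity for the product `g * He_n`. It moves
one derivative onto `g` for each degree. -/
theorem integral_mul_hermiteR_succ {g g' : ℝ → ℝ} (hg : PolyGrowth g) (hg' : PolyGrowth g')
    (hm : Measurable g') (hd : ∀ x, HasDerivAt g (g' x) x) (n : ℕ) :
    ∫ x, g x * (hermiteR (n + 1)).eval x ∂(gaussianReal 0 1)
      = ∫ x, g' x * (hermiteR n).eval x ∂(gaussianReal 0 1) := by
  have hc : Measurable g := (continuous_iff_continuousAt.2 fun x => (hd x).continuousAt).measurable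
  have hH (p : ℝ[X]) : Measurable fun x => p.eval x := p.continuous.measurable
  have key := gaussian_integral_deriv (hg.mul (PolyGrowth.eval (hermiteR n)))
    ((hg'.mul (PolyGrowth.eval (hermiteR n))).add
      (hg.mul (PolyGrowth.eval (derivative (hermiteR n)))))
    ((hm.mul (hH _)).add (hc.mul (hH _))) fun x => (hd x).mul ((hermiteR n).hasDerivAt x)
  rw [integral_add ((hg'.mul (PolyGrowth.eval _)).integrable 1 (hm.mul (hH _)))
    ((hg.mul (PolyGrowth.eval _)).integrable 1 (hc.mul (hH _))), ← eq_sub_iff_add_eq,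
    ← integral_sub ((PolyGrowth.id.mul (hg.mul (PolyGrowth.eval _))).integrable 1
      (measurable_id.mul (hc.mul (hH _)))) ((hg.mul (PolyGrowth.eval _)).integrable 1
        (hc.mul (hH _)))] at key
  rw [key]
  congr 1 with x
  rw [hermiteR_succ]
  simp
  ring

theorem integral_eval_mul_hermiteR (p : ℝ[X]) (n : ℕ) :
    ∫ x, p.eval x * (hermiteR n).eval x ∂(gaussianReal 0 1)
      = ∫ x, (derivative^[n] p).eval x ∂(gaussianReal 0 1) := by
  induction n generalizing p with
  | zero => simp [hermiteR_zero]
  | succ n ih =>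
    rw [integral_mul_hermiteR_succ (PolyGrowth.eval p) (PolyGrowth.eval (derivative p))
      (derivative p).continuous.measurable (fun x => p.hasDerivAt x), ih]
    rfl

theorem integral_eval_mul_hermiteR_of_natDegree_lt {p : ℝ[X]} {n : ℕ} (h : p.natDegree < n) :
    ∫ x, p.eval x * (hermiteR n).eval x ∂(gaussianReal 0 1) = 0 := by
  rw [integral_eval_mul_hermiteR, iterate_derivative_eq_zero h]
  simp

theorem iterate_derivative_hermiteR (n : ℕ) :
    derivative^[n] (hermiteR n) = C (n.factorial : ℝ) := by
  induction n with
  | zero => simp [hermiteR_zero]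
  | succ n ih =>
    rw [Function.iterate_succ_apply, derivative_hermiteR_succ, iterate_derivative_C_mul, ih, ← C_mul,
      Nat.factorial_succ]
    push_cast
    rfl

theorem integral_hermiteR_sq (n : ℕ) :
    ∫ x, (hermiteR n).eval x * (hermiteR n).eval x ∂(gaussianReal 0 1) = n.factorial := by
  rw [integral_eval_mul_hermiteR, iterate_derivative_hermiteR]
  simp

theorem integral_hermiteR_mul_of_ne {i j : ℕ} (h : i ≠ j) :
    ∫ x, (hermiteR i).eval x * (hermiteR j).eval x ∂(gaussianReal 0 1) = 0 := by
  rcases lt_or_gt_of_ne h with h | h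
  · exact integral_eval_mul_hermiteR_of_natDegree_lt (by rwa [natDegree_hermiteR])
  · simp_rw [mul_comm ((hermiteR i).eval _)]
    exact integral_eval_mul_hermiteR_of_natDegree_lt (by rwa [natDegree_hermiteR])

end Hermite

/-! ### Gauss–Hermite nodes, weights and exactness -/

section Nodes
open Polynomial

theorem mem_hermiteNodes {n : ℕ} {x : ℝ} : x ∈ hermiteNodes n ↔ (hermiteR n).eval x = 0 := by
  change x ∈ (hermiteR n).roots.toFinset ↔ _
  rw [Multiset.mem_toFinset, mem_roots (monic_hermiteR n).ne_zero, IsRoot.def]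

/-- By the three-term recurrence, a common zero of two consecutive polynomials would descend to
`He_0 = 1`. -/
theorem eval_hermiteR_succ_ne_zero {n : ℕ} {x : ℝ} (h : (hermiteR n).eval x = 0) :
    (hermiteR (n + 1)).eval x ≠ 0 := by
  induction n with
  | zero => simp [hermiteR_zero] at h
  | succ n ih =>
    intro h2
    rw [eval_hermiteR_succ_succ, h] at h2
    have h3 : (hermiteR n).eval x = 0 := by
      have : ((n : ℝ) + 1) ≠ 0 := by positivity
      simpa [this] using h2
    exact ih h3 h

theorem nodup_roots_hermiteR (n : ℕ) : (hermiteR n).roots.Nodup := by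
  rw [Multiset.nodup_iff_count_le_one]
  intro a
  rw [count_roots]
  by_contra! h
  rw [one_lt_rootMultiplicity_iff_isRoot (monic_hermiteR n).ne_zero] at h
  cases n with
  | zero => simp [hermiteR_zero] at h
  | succ n =>
    rw [derivative_hermiteR_succ] at h
    have : ((n : ℝ) + 1) ≠ 0 := by positivity
    have h2 : (hermiteR n).eval a = 0 := by simpa [this] using h.2
    exact eval_hermiteR_succ_ne_zero h2 h.1

theorem eq_zero_of_integral_gaussian_eq_zero {p : ℝ[X]} (hp : ∀ x, 0 ≤ p.eval x)
    (h : ∫ x, p.eval x ∂(gaussianReal 0 1) = 0) : p = 0 := by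
  have hi := (PolyGrowth.eval p).integrable 1 p.continuous.measurable
  have h1 := (integral_eq_zero_iff_of_nonneg hp hi).1 h
  have h2 : (fun x => p.eval x) =ᵐ[volume] fun _ => (0 : ℝ) :=
    (gaussianReal_absolutelyContinuous' 0 one_ne_zero).ae_le h1
  have h3 := (Continuous.ae_eq_iff_eq volume p.continuous continuous_const).1 h2
  exact Polynomial.funext fun x => by simpa using congrFun h3 x

theorem eval_pos_or_neg_of_roots_eq_zero {q : ℝ[X]} (hq0 : q ≠ 0) (hq : q.roots = 0) :
    (∀ x, 0 ≤ q.eval x) ∨ ∀ x, 0 ≤ (-q).eval x := by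
  by_contra! h
  obtain ⟨⟨a, ha⟩, b, hb⟩ := h
  have hb' : 0 ≤ q.eval b := by
    rw [eval_neg] at hb; linarith
  obtain ⟨c, hc⟩ := mem_range_of_exists_le_of_exists_ge q.continuous ⟨a, ha.le⟩ ⟨b, hb'⟩
  have : c ∈ q.roots := (mem_roots hq0).2 hc
  simp [hq] at this

/-- If the real roots numbered fewer than `n`, write `He_n = p q` with `p` the product over these
roots and `q` without real roots, hence of constant sign. Orthogonality to `p` makes `∫ p² q = 0`,
which forces `p² q = 0`. -/
theorem card_hermiteNodes (n : ℕ) : (hermiteNodes n).card = n := by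
  change (hermiteR n).roots.toFinset.card = n
  rw [Multiset.toFinset_card_of_nodup (nodup_roots_hermiteR n)]
  obtain ⟨q, hq, hdeg, hroots⟩ := exists_prod_multiset_X_sub_C_mul (hermiteR n)
  rw [natDegree_hermiteR] at hdeg
  by_contra hne
  have hlt : (hermiteR n).roots.card < n := by omega
  set p := ((hermiteR n).roots.map fun a => X - C a).prod with hp
  have hpd : p.natDegree < n := by
    rwa [hp, natDegree_multiset_prod_X_sub_C_eq_card]
  have hH0 := (monic_hermiteR n).ne_zero
  have hp0 : p ≠ 0 := fun h => hH0 (by rw [← hq, h, zero_mul])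
  have hq0 : q ≠ 0 := fun h => hH0 (by rw [← hq, h, mul_zero])
  have hint := integral_eval_mul_hermiteR_of_natDegree_lt hpd
  rw [← hq] at hint
  have hpq : p ^ 2 * q ≠ 0 := mul_ne_zero (pow_ne_zero 2 hp0) hq0
  rcases eval_pos_or_neg_of_roots_eq_zero hq0 hroots with h | h
  · refine hpq (eq_zero_of_integral_gaussian_eq_zero (fun x => ?_) ?_)
    · rw [eval_mul, eval_pow]
      exact mul_nonneg (sq_nonneg _) (h x)
    · refine (integral_congr_ae (ae_of_all _ fun x => ?_)).trans hint
      simp; ring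
  · refine mul_ne_zero (pow_ne_zero 2 hp0) (neg_ne_zero.2 hq0)
      (eq_zero_of_integral_gaussian_eq_zero (p := p ^ 2 * -q) (fun x => ?_) ?_)
    · rw [eval_mul, eval_pow]
      exact mul_nonneg (sq_nonneg _) (h x)
    · rw [← neg_eq_zero, ← integral_neg]
      refine (integral_congr_ae (ae_of_all _ fun x => ?_)).trans hint
      simp; ring

theorem gaussHermite_one (n : ℕ) (f : ℝ → ℝ) :
    gaussHermite n 1 f = ∑ x ∈ hermiteNodes n, gaussHermiteWeight n x * f x := by
  simp [gaussHermite]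

theorem integral_eval_add (p q : ℝ[X]) :
    ∫ x, (p + q).eval x ∂(gaussianReal 0 1)
      = ∫ x, p.eval x ∂(gaussianReal 0 1) + ∫ x, q.eval x ∂(gaussianReal 0 1) := by
  simp only [eval_add]
  exact integral_add ((PolyGrowth.eval p).integrable 1 p.continuous.measurable)
    ((PolyGrowth.eval q).integrable 1 q.continuous.measurable)

theorem integral_eval_C_mul (c : ℝ) (q : ℝ[X]) :
    ∫ x, (C c * q).eval x ∂(gaussianReal 0 1) = c * ∫ x, q.eval x ∂(gaussianReal 0 1) := by
  simp only [eval_mul, eval_C]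
  exact integral_const_mul _ _

theorem gaussHermite_eval_of_degree_lt {n : ℕ} {r : ℝ[X]} (hr : r.degree < n) :
    gaussHermite n 1 (fun x => r.eval x) = ∫ x, r.eval x ∂(gaussianReal 0 1) := by
  have hr' : r.degree < (hermiteNodes n).card := by rwa [card_hermiteNodes]
  have h := Lagrange.eq_interpolate (f := r) (v := id) (s := hermiteNodes n)
    Function.injective_id.injOn hr'
  rw [gaussHermite_one]
  conv_rhs => rw [h]
  rw [Lagrange.interpolate_apply]
  simp only [eval_finsetSum, eval_mul, eval_C, id]
  rw [integral_finsetSum _ fun i _ => ((PolyGrowth.eval _).integrable 1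
    (Polynomial.continuous _).measurable).const_mul _]
  refine Finset.sum_congr rfl fun x _ => ?_
  rw [integral_const_mul, mul_comm]
  rfl

/-- Divide by `He_n`: the quotient part vanishes at the nodes, and its integral vanishes by
orthogonality because the quotient has degree below `n`. The remainder is interpolated exactly. -/
theorem gaussHermite_eval_of_natDegree_lt {n : ℕ} {p : ℝ[X]} (hp : p.natDegree < 2 * n) :
    gaussHermite n 1 (fun x => p.eval x) = ∫ x, p.eval x ∂(gaussianReal 0 1) := by
  have hm := monic_hermiteR n
  have hn : 0 < n := by omega
  have hr : (p %ₘ hermiteR n).degree < n := by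
    have := degree_modByMonic_lt p hm
    rwa [degree_eq_natDegree hm.ne_zero, natDegree_hermiteR] at this
  have hq : (p /ₘ hermiteR n).natDegree < n := by
    rw [natDegree_divByMonic _ hm, natDegree_hermiteR]; omega
  have hdiv := modByMonic_add_div p (hermiteR n)
  have h1 : gaussHermite n 1 (fun x => p.eval x)
      = gaussHermite n 1 (fun x => (p %ₘ hermiteR n).eval x) := by
    rw [gaussHermite_one, gaussHermite_one]
    refine Finset.sum_congr rfl fun x hx => ?_
    rw [mem_hermiteNodes] at hx
    conv_lhs => rw [← hdiv]
    simp [hx]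
  rw [h1, gaussHermite_eval_of_degree_lt hr]
  conv_rhs => rw [← hdiv]
  rw [integral_eval_add]
  have h2 := integral_eval_mul_hermiteR_of_natDegree_lt hq
  simp only [eval_mul, mul_comm ((hermiteR n).eval _), h2, add_zero]

/-- The squared Lagrange basis polynomial has degree `2n - 2`, so the rule is exact on it, and its
quadrature sum is the weight itself. -/
theorem gaussHermiteWeight_nonneg {n : ℕ} {x : ℝ} (hx : x ∈ hermiteNodes n) :
    0 ≤ gaussHermiteWeight n x := by
  have hn : 0 < n := by
    rw [← card_hermiteNodes n]; exact Finset.card_pos.2 ⟨x, hx⟩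
  set b := Lagrange.basis (hermiteNodes n) id x with hb
  have hbd : b.natDegree = n - 1 := by
    rw [hb, Lagrange.natDegree_basis Function.injective_id.injOn hx, card_hermiteNodes]
  have h := gaussHermite_eval_of_natDegree_lt (n := n) (p := b ^ 2)
    (by rw [natDegree_pow, hbd]; omega)
  rw [gaussHermite_one, Finset.sum_eq_single_of_mem x hx] at h
  · have h1 : b.eval x = 1 := Lagrange.eval_basis_self Function.injective_id.injOn hx
    rw [eval_pow, h1, one_pow, mul_one] at h
    rw [h]
    exact integral_nonneg fun y => by simp only [eval_pow]; positivity
  · intro y hy hne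
    have h1 : b.eval y = 0 := Lagrange.eval_basis_of_ne (v := id) hne.symm hy
    simp [h1]

theorem abs_gaussHermite_one_le {n : ℕ} {f g : ℝ → ℝ} (h : ∀ x ∈ hermiteNodes n, |f x| ≤ g x) :
    |gaussHermite n 1 f| ≤ gaussHermite n 1 g := by
  rw [gaussHermite_one, gaussHermite_one]
  refine (Finset.abs_sum_le_sum_abs _ _).trans (Finset.sum_le_sum fun x hx => ?_)
  rw [abs_mul, abs_of_nonneg (gaussHermiteWeight_nonneg hx)]
  exact mul_le_mul_of_nonneg_left (h x hx) (gaussHermiteWeight_nonneg hx)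

theorem gaussHermite_const_mul (n : ℕ) (v : ℝ≥0) (c : ℝ) (f : ℝ → ℝ) :
    gaussHermite n v (fun x => c * f x) = c * gaussHermite n v f := by
  simp only [gaussHermite, Finset.mul_sum]
  exact Finset.sum_congr rfl fun x _ => by ring

theorem gaussHermite_add (n : ℕ) (v : ℝ≥0) (f g : ℝ → ℝ) :
    gaussHermite n v (fun x => f x + g x) = gaussHermite n v f + gaussHermite n v g := by
  simp only [gaussHermite, mul_add, Finset.sum_add_distrib]

theorem gaussHermite_sum {ι : Type*} (s : Finset ι) (n : ℕ) (v : ℝ≥0) (f : ι → ℝ → ℝ) :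
    gaussHermite n v (fun x => ∑ i ∈ s, f i x) = ∑ i ∈ s, gaussHermite n v (f i) := by
  simp only [gaussHermite, Finset.mul_sum]
  exact Finset.sum_comm

/-- The Gauss–Hermite rule underestimates `x ^ k He_j` for every `k` and every `j ≤ n`. -/
theorem gaussHermite_X_pow_mul_hermiteR (n k : ℕ) : ∀ j ≤ n,
    0 ≤ gaussHermite n 1 (fun x => (X ^ k * hermiteR j).eval x) ∧
    gaussHermite n 1 (fun x => (X ^ k * hermiteR j).eval x)
      ≤ ∫ x, (X ^ k * hermiteR j).eval x ∂(gaussianReal 0 1) := by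
  have hzero (k : ℕ) : gaussHermite n 1 (fun x => (X ^ k * hermiteR n).eval x) = 0 := by
    rw [gaussHermite_one]
    refine Finset.sum_eq_zero fun x hx => ?_
    rw [mem_hermiteNodes] at hx
    simp [hx]
  have hint (j : ℕ) : 0 ≤ ∫ x, (X ^ 0 * hermiteR j).eval x ∂(gaussianReal 0 1) := by
    rcases Nat.eq_zero_or_pos j with rfl | hj
    · simp [hermiteR_zero]
    · have := integral_eval_mul_hermiteR_of_natDegree_lt (p := 1) (n := j) (by simpa using hj)
      simpa using this.ge
  have hsucc0 (k : ℕ) : (X ^ (k + 1) * hermiteR 0 : ℝ[X]) = X ^ k * hermiteR 1 := by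
    rw [hermiteR_zero, hermiteR_one]; ring
  have hintk (k : ℕ) : ∀ j, 0 ≤ ∫ x, (X ^ k * hermiteR j).eval x ∂(gaussianReal 0 1) := by
    induction k with
    | zero => exact hint
    | succ k ih =>
      intro j
      cases j with
      | zero => rw [hsucc0]; exact ih 1
      | succ j =>
        rw [X_pow_succ_mul_hermiteR_succ, integral_eval_add, integral_eval_C_mul]
        exact add_nonneg (ih _) (mul_nonneg (by positivity) (ih _))
  -- The identity `x He_{j+1} = He_{j+2} + (j+1) He_j` has nonnegative coefficients, so both bounds
  -- pass from `k` to `k + 1`. The index stays at most `n` because `j = n` is handled apart: `He_n`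
  -- vanishes at all nodes.
  induction k with
  | zero =>
    intro j hj
    rcases hj.eq_or_lt with rfl | hj
    · rw [hzero]; exact ⟨le_rfl, hint j⟩
    · rw [gaussHermite_eval_of_natDegree_lt (by
        simp only [pow_zero, one_mul, natDegree_hermiteR]; omega)]
      exact ⟨hint j, le_rfl⟩
  | succ k ih =>
    intro j hj
    rcases hj.eq_or_lt with rfl | hj
    · rw [hzero]; exact ⟨le_rfl, hintk _ _⟩
    cases j with
    | zero => rw [hsucc0]; exact ih 1 hj
    | succ j =>
      obtain ⟨h1, h2⟩ := ih (j + 2) hj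
      obtain ⟨h3, h4⟩ := ih j (by omega)
      have hc : (0 : ℝ) ≤ (j : ℝ) + 1 := by positivity
      rw [X_pow_succ_mul_hermiteR_succ, integral_eval_add, integral_eval_C_mul]
      have : gaussHermite n 1 (fun x => (X ^ k * hermiteR (j + 2)
          + C ((j : ℝ) + 1) * (X ^ k * hermiteR j)).eval x)
          = gaussHermite n 1 (fun x => (X ^ k * hermiteR (j + 2)).eval x)
            + ((j : ℝ) + 1) * gaussHermite n 1 (fun x => (X ^ k * hermiteR j).eval x) := by
        rw [← gaussHermite_const_mul, ← gaussHermite_add]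
        simp only [eval_add, eval_C_mul]
      rw [this]
      exact ⟨add_nonneg h1 (mul_nonneg hc h3), add_le_add h2 (mul_le_mul_of_nonneg_left h4 hc)⟩

theorem gaussHermite_pow_le (n k : ℕ) :
    gaussHermite n 1 (fun x => x ^ k) ≤ ∫ x, x ^ k ∂(gaussianReal 0 1) := by
  have := (gaussHermite_X_pow_mul_hermiteR n k 0 (Nat.zero_le _)).2
  simpa [hermiteR_zero] using this

theorem integrable_exp_sq_div_four :
    Integrable (fun x : ℝ => Real.exp (x ^ 2 / 4)) (gaussianReal 0 1) := by
  rw [integrable_gaussianReal_iff one_ne_zero]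
  have := (integrable_exp_neg_mul_sq (b := 1 / 4) (by norm_num)).const_mul
    (√(2 * Real.pi * ((1 : ℝ≥0) : ℝ)))⁻¹
  refine this.congr (ae_of_all _ fun x => ?_)
  simp only [gaussianPDFReal]
  rw [mul_left_comm, ← Real.exp_add]
  congr 2
  simp
  ring

/-- The Taylor coefficients of `exp (x²/4)` are nonnegative, so the moment inequality can be summed.
The exponent matches the Cramér bound and remains integrable against `exp (-x²/2)`. -/
theorem gaussHermite_exp_le (n : ℕ) :
    gaussHermite n 1 (fun x => Real.exp (x ^ 2 / 4))
      ≤ ∫ x, Real.exp (x ^ 2 / 4) ∂(gaussianReal 0 1) := by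
  have hs (x : ℝ) : HasSum (fun k : ℕ => (4 ^ k * k.factorial : ℝ)⁻¹ * x ^ (2 * k))
      (Real.exp (x ^ 2 / 4)) := by
    have := NormedSpace.expSeries_div_hasSum_exp (𝔸 := ℝ) (x ^ 2 / 4)
    rw [← Real.exp_eq_exp_ℝ] at this
    convert! this using 2 with k
    rw [div_pow, pow_mul]
    field_simp
  have hsum : HasSum (fun k : ℕ => gaussHermite n 1
      (fun x => (4 ^ k * k.factorial : ℝ)⁻¹ * x ^ (2 * k)))
      (gaussHermite n 1 (fun x => Real.exp (x ^ 2 / 4))) := by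
    simp only [gaussHermite_one]
    exact hasSum_sum fun x _ => (hs x).mul_left _
  have hpg (k : ℕ) : Integrable (fun x : ℝ => (4 ^ k * k.factorial : ℝ)⁻¹ * x ^ (2 * k))
      (gaussianReal 0 1) :=
    ((PolyGrowth.const _).mul (PolyGrowth.id.pow _)).integrable 1 (by fun_prop)
  refine hasSum_le_of_sum_le hsum fun s => ?_
  calc _ ≤ ∑ k ∈ s, ∫ x, (4 ^ k * k.factorial : ℝ)⁻¹ * x ^ (2 * k) ∂(gaussianReal 0 1) := by
        refine Finset.sum_le_sum fun k _ => ?_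
        rw [gaussHermite_const_mul, integral_const_mul]
        exact mul_le_mul_of_nonneg_left (gaussHermite_pow_le n _) (by positivity)
    _ = ∫ x, ∑ k ∈ s, (4 ^ k * k.factorial : ℝ)⁻¹ * x ^ (2 * k) ∂(gaussianReal 0 1) :=
        (integral_finsetSum _ fun k _ => hpg k).symm
    _ ≤ _ := by
        refine integral_mono (integrable_finsetSum _ fun k _ => hpg k)
          integrable_exp_sq_div_four fun x => ?_
        exact sum_le_hasSum s (fun k _ => by rw [pow_mul]; positivity) (hs x)

/-- For `|x| ≥ 2√n` the recurrence propagates `|He_{k+1}(x)| ≥ √n |He_k(x)|` for all `k < n`,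
starting from `He_0 = 1`, so `He_n(x)` cannot vanish. -/
theorem sq_lt_of_mem_hermiteNodes {n : ℕ} {x : ℝ} (hx : x ∈ hermiteNodes n) :
    x ^ 2 < 4 * n := by
  by_contra! h
  rw [mem_hermiteNodes] at hx
  set s := √(n : ℝ) with hs
  have hs2 : s ^ 2 = n := Real.sq_sqrt (Nat.cast_nonneg n)
  have hs0 : 0 ≤ s := Real.sqrt_nonneg _
  have hxs : 2 * s ≤ |x| := by
    rw [← abs_of_nonneg (by positivity : 0 ≤ 2 * s), ← sq_le_sq]
    nlinarith
  have key : ∀ k < n, 0 < |(hermiteR k).eval x| ∧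
      s * |(hermiteR k).eval x| ≤ |(hermiteR (k + 1)).eval x| := by
    intro k
    induction k with
    | zero => intro _; simp [hermiteR_zero, hermiteR_one]; linarith
    | succ k ih =>
      intro hk
      obtain ⟨h1, h2⟩ := ih (by omega)
      have hspos : 0 < s := Real.sqrt_pos.2 (by exact_mod_cast (by omega : 0 < n))
      refine ⟨lt_of_lt_of_le (mul_pos hspos h1) h2, ?_⟩
      rw [eval_hermiteR_succ_succ]
      have hkn : (k : ℝ) + 1 ≤ s * s := by
        rw [← sq, hs2]; exact_mod_cast hk.le
      calc s * |(hermiteR (k + 1)).eval x|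
          = 2 * s * |(hermiteR (k + 1)).eval x| - s * |(hermiteR (k + 1)).eval x| := by ring
        _ ≤ |x| * |(hermiteR (k + 1)).eval x| - s * (s * |(hermiteR k).eval x|) := by gcongr
        _ ≤ |x| * |(hermiteR (k + 1)).eval x| - ((k : ℝ) + 1) * |(hermiteR k).eval x| := by
            rw [← mul_assoc]; gcongr
        _ = |x * (hermiteR (k + 1)).eval x| - |((k : ℝ) + 1) * (hermiteR k).eval x| := by
            rw [abs_mul, abs_mul, abs_of_nonneg (by positivity : (0 : ℝ) ≤ (k : ℝ) + 1)]
        _ ≤ _ := abs_sub_abs_le_abs_sub _ _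
  cases n with
  | zero => simp [hermiteR_zero] at hx
  | succ n =>
    obtain ⟨h1, h2⟩ := key n (by omega)
    have hspos : 0 < s := Real.sqrt_pos.2 (by positivity)
    rw [hx, abs_zero] at h2
    exact absurd h2 (not_le.2 (mul_pos hspos h1))

end Nodes

/-! ### A Cramér-type bound for Hermite polynomials -/

section Cramer
open Polynomial

theorem derivative_derivative_hermiteR (n : ℕ) :
    derivative (derivative (hermiteR n)) = X * derivative (hermiteR n) - C (n : ℝ) * hermiteR n := by
  have h := derivative_hermiteR_succ n
  rw [hermiteR_succ, derivative_sub, derivative_mul, derivative_X, one_mul, C_add, C_1] at h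
  linear_combination -h

theorem eval_zero_hermiteR_sq_le (n : ℕ) : (hermiteR n).eval 0 ^ 2 ≤ n.factorial := by
  induction n using Nat.twoStepInduction with
  | zero => simp [hermiteR_zero]
  | one => simp [hermiteR_one]
  | more n ih _ =>
    rw [eval_hermiteR_succ_succ, Nat.factorial_succ, Nat.factorial_succ]
    push_cast
    have hn : (0 : ℝ) ≤ (n : ℝ) + 1 := by positivity
    calc (0 * (hermiteR (n + 1)).eval 0 - ((n : ℝ) + 1) * (hermiteR n).eval 0) ^ 2
        = ((n : ℝ) + 1) * (((n : ℝ) + 1) * (hermiteR n).eval 0 ^ 2) := by ring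
      _ ≤ ((n : ℝ) + 1 + 1) * (((n : ℝ) + 1) * n.factorial) := by gcongr; linarith

theorem eval_zero_derivative_hermiteR_sq_le (n : ℕ) :
    (derivative (hermiteR n)).eval 0 ^ 2 ≤ n * n.factorial := by
  cases n with
  | zero => simp [hermiteR_zero]
  | succ n =>
    rw [derivative_hermiteR_succ, Nat.factorial_succ]
    push_cast
    rw [eval_C_mul, mul_pow, sq, mul_assoc]
    have := eval_zero_hermiteR_sq_le n
    gcongr

/-- The Sonin function of the Hermite function of order `n`. -/
noncomputable def sonin (n : ℕ) (x : ℝ) : ℝ :=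
  Real.exp (-(x ^ 2 / 2)) * (((n : ℝ) + 1 / 2 - x ^ 2 / 4) * (hermiteR n).eval x ^ 2
    + ((derivative (hermiteR n)).eval x - x / 2 * (hermiteR n).eval x) ^ 2)

/-- With `ψ = exp(-x²/4) He_n` and `q = n + 1/2 - x²/4`, one has `ψ'' + q ψ = 0`. The Sonin function
is `q ψ² + ψ'²`, so its derivative reduces to `q' ψ²`, whose sign is opposite to that of `x`. -/
theorem hasDerivAt_sonin (n : ℕ) (x : ℝ) :
    HasDerivAt (sonin n) (-(x / 2) * (Real.exp (-(x ^ 2 / 2)) * (hermiteR n).eval x ^ 2)) x := by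
  have h0 := (hermiteR n).hasDerivAt x
  have h1 := (derivative (hermiteR n)).hasDerivAt x
  rw [derivative_derivative_hermiteR] at h1
  have he : HasDerivAt (fun x : ℝ => Real.exp (-(x ^ 2 / 2))) (Real.exp (-(x ^ 2 / 2)) * -x) x := by
    have := (((hasDerivAt_pow 2 x).div_const 2).neg).exp
    convert! this using 1
    simp
  have hq : HasDerivAt (fun x : ℝ => (n : ℝ) + 1 / 2 - x ^ 2 / 4) (-(x / 2)) x := by
    have := ((hasDerivAt_pow 2 x).div_const 4).const_sub ((n : ℝ) + 1 / 2)
    convert! this using 1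
    simp; ring
  have hx : HasDerivAt (fun x : ℝ => x / 2) (1 / 2) x := (hasDerivAt_id x).div_const 2
  have := he.mul ((hq.mul (h0.pow 2)).add ((h1.sub (hx.mul h0)).pow 2))
  convert! this using 1
  simp only [eval_sub, eval_mul, eval_X, eval_C, Pi.mul_apply, Pi.add_apply, Pi.sub_apply,
    Pi.pow_apply]
  push_cast
  ring

theorem sonin_le_sonin_zero (n : ℕ) (x : ℝ) : sonin n x ≤ sonin n 0 := by
  have hd : Differentiable ℝ (sonin n) := fun x => (hasDerivAt_sonin n x).differentiableAt
  have hpos (x : ℝ) : 0 ≤ Real.exp (-(x ^ 2 / 2)) * (hermiteR n).eval x ^ 2 := by positivity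
  rcases le_total 0 x with hx | hx
  · have : AntitoneOn (sonin n) (Set.Ici 0) :=
      antitoneOn_of_deriv_nonpos (convex_Ici 0) hd.continuous.continuousOn hd.differentiableOn
        fun y hy => by
          rw [interior_Ici, Set.mem_Ioi] at hy
          rw [(hasDerivAt_sonin n y).deriv]
          nlinarith [hpos y]
    exact this Set.self_mem_Ici hx hx
  · have : MonotoneOn (sonin n) (Set.Iic 0) :=
      monotoneOn_of_deriv_nonneg (convex_Iic 0) hd.continuous.continuousOn hd.differentiableOn
        fun y hy => by
          rw [interior_Iic, Set.mem_Iio] at hy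
          rw [(hasDerivAt_sonin n y).deriv]
          nlinarith [hpos y]
    exact this hx Set.self_mem_Iic hx

/-- The Sonin function is largest at 0, where it is at most `(2n+1) n!`. When `x² ≤ 2n`, the factor
`q` is at least `(n+1)/2`, and the ratio of these two bounds is at most `4 n!`. -/
theorem abs_eval_hermiteR_le {n : ℕ} {x : ℝ} (hx : x ^ 2 ≤ 2 * n) :
    |(hermiteR n).eval x| ≤ 2 * √(n.factorial : ℝ) * Real.exp (x ^ 2 / 4) := by
  have h0 : sonin n 0 ≤ (2 * (n : ℝ) + 1) * n.factorial := by
    have h1 := eval_zero_hermiteR_sq_le n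
    have h2 := eval_zero_derivative_hermiteR_sq_le n
    have h3 : (0 : ℝ) ≤ (n : ℝ) + 1 / 2 := by positivity
    have h4 : (0 : ℝ) ≤ n.factorial := by positivity
    simp only [sonin]
    norm_num
    nlinarith [mul_le_mul_of_nonneg_left h1 h3]
  have h1 := (sonin_le_sonin_zero n x).trans h0
  set E := Real.exp (-(x ^ 2 / 2)) with hE
  have hE0 : 0 < E := Real.exp_pos _
  set H := (hermiteR n).eval x
  have h2 : ((n : ℝ) + 1) / 2 * (E * H ^ 2) ≤ (2 * (n : ℝ) + 1) * n.factorial := by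
    refine le_trans ?_ h1
    simp only [sonin, ← hE]
    have h3 : 0 ≤ E * ((derivative (hermiteR n)).eval x - x / 2 * H) ^ 2 := by positivity
    have h4 : ((n : ℝ) + 1) / 2 * (E * H ^ 2)
        ≤ ((n : ℝ) + 1 / 2 - x ^ 2 / 4) * (E * H ^ 2) := by
      gcongr
      linarith
    linarith
  have h3 : E * H ^ 2 ≤ 4 * n.factorial := by
    have hn : (0 : ℝ) < ((n : ℝ) + 1) / 2 := by positivity
    refine le_of_mul_le_mul_left (h2.trans ?_) hn
    have h4 : (0 : ℝ) ≤ n.factorial := by positivity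
    nlinarith
  have hF : Real.exp (x ^ 2 / 4) ^ 2 * E = 1 := by
    rw [hE, ← Real.exp_nat_mul, ← Real.exp_add]
    simp; ring
  refine abs_le_of_sq_le_sq ?_ (by positivity)
  rw [mul_pow, mul_pow, Real.sq_sqrt (by positivity)]
  calc H ^ 2 = Real.exp (x ^ 2 / 4) ^ 2 * (E * H ^ 2) := by rw [← mul_assoc, hF, one_mul]
    _ ≤ Real.exp (x ^ 2 / 4) ^ 2 * (4 * n.factorial) := by gcongr
    _ = _ := by ring

end Cramer

/-! ### Completeness and pointwise convergence of Hermite series -/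

section Completeness
open Filter Topology

theorem memLp_exp_abs_mul (t : ℝ) :
    MemLp (fun x : ℝ => Real.exp |t * x|) 2 (gaussianReal 0 1) := by
  have hm : Continuous fun x : ℝ => Real.exp |t * x| := by fun_prop
  rw [memLp_two_iff_integrable_sq hm.aestronglyMeasurable]
  refine ((integrable_exp_mul_gaussianReal (μ := 0) (v := 1) (2 * t)).add
    (integrable_exp_mul_gaussianReal (μ := 0) (v := 1) (-(2 * t)))).mono'
      (hm.pow 2).aestronglyMeasurable (ae_of_all _ fun x => ?_)
  rw [Real.norm_of_nonneg (by positivity), ← Real.exp_nat_mul]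
  simp only [Pi.add_apply]
  rcases le_total 0 (t * x) with h | h
  · rw [abs_of_nonneg h]
    have : Real.exp (↑(2 : ℕ) * (t * x)) = Real.exp (2 * t * x) := by push_cast; ring_nf
    rw [this]
    linarith [Real.exp_pos (-(2 * t) * x)]
  · rw [abs_of_nonpos h]
    have : Real.exp (↑(2 : ℕ) * (-(t * x))) = Real.exp (-(2 * t) * x) := by push_cast; ring_nf
    rw [this]
    linarith [Real.exp_pos (2 * t * x)]

/-- Expand the exponential in powers of `x`. The series is dominated by `exp |t x| * |f x|`,
integrable as a product of two `L²` functions. -/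
theorem integral_cexp_mul_eq_zero {f : ℝ → ℝ} (hf : MemLp f 2 (gaussianReal 0 1))
    (h : ∀ k : ℕ, ∫ x, f x * x ^ k ∂(gaussianReal 0 1) = 0) (t : ℝ) :
    ∫ x, Complex.exp (t * x * Complex.I) * f x ∂(gaussianReal 0 1) = 0 := by
  have hs (x : ℝ) : HasSum (fun k : ℕ => (t * x * Complex.I) ^ k / k.factorial * (f x : ℂ))
      (Complex.exp (t * x * Complex.I) * f x) := by
    have := NormedSpace.expSeries_div_hasSum_exp (𝔸 := ℂ) (t * x * Complex.I)
    rw [← Complex.exp_eq_exp_ℂ] at this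
    exact this.mul_right _
  have hb (x : ℝ) : HasSum (fun k : ℕ => |t * x| ^ k / k.factorial * |f x|)
      (Real.exp |t * x| * |f x|) := by
    have := NormedSpace.expSeries_div_hasSum_exp (𝔸 := ℝ) |t * x|
    rw [← Real.exp_eq_exp_ℝ] at this
    exact this.mul_right _
  have hfm := hf.aestronglyMeasurable
  have key := hasSum_integral_of_dominated_convergence (μ := gaussianReal 0 1)
    (F := fun (k : ℕ) (x : ℝ) => (t * x * Complex.I) ^ k / k.factorial * (f x : ℂ))
    (f := fun x : ℝ => Complex.exp (t * x * Complex.I) * f x)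
    (fun k x => |t * x| ^ k / k.factorial * |f x|)
    (fun k => (Continuous.aestronglyMeasurable (by fun_prop)).mul
      (Complex.continuous_ofReal.comp_aestronglyMeasurable hfm))
    (fun k => ae_of_all _ fun x => by simp [abs_mul, mul_pow])
    (ae_of_all _ fun x => (hb x).summable)
    (by
      simp only [(hb _).tsum_eq]
      exact (memLp_exp_abs_mul t).integrable_mul hf.abs)
    (ae_of_all _ hs)
  have hz : ∀ k : ℕ, ∫ x : ℝ, (t * x * Complex.I) ^ k / k.factorial * (f x : ℂ)
      ∂(gaussianReal 0 1) = 0 := by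
    intro k
    have : (fun x : ℝ => (t * x * Complex.I) ^ k / k.factorial * (f x : ℂ))
        = fun x : ℝ => ((t * Complex.I) ^ k / k.factorial) * ((f x * x ^ k : ℝ) : ℂ) := by
      ext x; push_cast; ring
    rw [this, integral_const_mul, integral_complex_ofReal, h k]
    simp
  simp only [hz] at key
  exact key.unique hasSum_zero

/-- The positive and negative parts of `f` are densities of two finite measures with equal
characteristic functions, so the measures agree. -/
theorem ae_eq_zero_of_integral_mul_pow_eq_zero {f : ℝ → ℝ} (hf : MemLp f 2 (gaussianReal 0 1))
    (h : ∀ k : ℕ, ∫ x, f x * x ^ k ∂(gaussianReal 0 1) = 0) : f =ᵐ[gaussianReal 0 1] 0 := by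
  have hi : Integrable f (gaussianReal 0 1) := hf.integrable (by norm_num)
  have hm := hi.aestronglyMeasurable.aemeasurable
  have hexp (t : ℝ) (g : ℝ → ℝ) (hg : Integrable g (gaussianReal 0 1)) :
      Integrable (fun x : ℝ => Complex.exp (t * x * Complex.I) * g x) (gaussianReal 0 1) := by
    refine hg.mono ((Continuous.aestronglyMeasurable (by fun_prop)).mul
      (Complex.continuous_ofReal.comp_aestronglyMeasurable hg.aestronglyMeasurable))
      (ae_of_all _ fun x => ?_)
    have : (t * x * Complex.I : ℂ) = ((t * x : ℝ) : ℂ) * Complex.I := by push_cast; ring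
    rw [norm_mul, this, Complex.norm_exp_ofReal_mul_I]
    simp
  have hfin : IsFiniteMeasure ((gaussianReal 0 1).withDensity fun x => ENNReal.ofReal (f x)) :=
    isFiniteMeasure_withDensity_ofReal hi.2
  have hfin' : IsFiniteMeasure ((gaussianReal 0 1).withDensity fun x => ENNReal.ofReal (-f x)) :=
    isFiniteMeasure_withDensity_ofReal hi.neg.2
  have hchar (g : ℝ → ℝ) (hg : AEMeasurable g (gaussianReal 0 1)) (t : ℝ) :
      charFun ((gaussianReal 0 1).withDensity fun x => ENNReal.ofReal (g x)) t
        = ∫ x, Complex.exp (t * x * Complex.I) * ((max (g x) 0 : ℝ) : ℂ) ∂(gaussianReal 0 1) := by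
    rw [charFun_apply_real, integral_withDensity_eq_integral_toReal_smul₀ hg.ennreal_ofReal
      (ae_of_all _ fun x => ENNReal.ofReal_lt_top)]
    congr 1 with x
    rw [ENNReal.toReal_ofReal', Complex.real_smul, mul_comm]
  have heq : (gaussianReal 0 1).withDensity (fun x => ENNReal.ofReal (f x))
      = (gaussianReal 0 1).withDensity (fun x => ENNReal.ofReal (-f x)) := by
    refine Measure.ext_of_charFun (funext fun t => ?_)
    rw [hchar f hm, hchar (fun x => -f x) hm.neg, ← sub_eq_zero,
      ← integral_sub (hexp t _ hi.pos_part) (hexp t _ hi.neg_part)]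
    refine Eq.trans (integral_congr_ae (ae_of_all _ fun x => ?_))
      (integral_cexp_mul_eq_zero hf h t)
    simp only
    rw [← mul_sub, ← Complex.ofReal_sub]
    congr 2
    rcases le_total 0 (f x) with hx | hx
    · rw [max_eq_left hx, max_eq_right (by linarith)]; ring
    · rw [max_eq_right hx, max_eq_left (by linarith)]; ring
  have hlint : ∫⁻ x, ENNReal.ofReal (f x) ∂(gaussianReal 0 1) ≠ ⊤ := by
    rw [← setLIntegral_univ, ← withDensity_apply _ MeasurableSet.univ]
    exact measure_ne_top _ _
  have hae := (withDensity_eq_iff hm.ennreal_ofReal hm.neg.ennreal_ofReal hlint).1 heq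
  filter_upwards [hae] with x hx
  have := congrArg ENNReal.toReal hx
  rw [ENNReal.toReal_ofReal', ENNReal.toReal_ofReal'] at this
  simp only [Pi.neg_apply] at this
  rcases le_total 0 (f x) with h0 | h0
  · rw [max_eq_left h0, max_eq_right (by linarith)] at this; simpa using this
  · rw [max_eq_right h0, max_eq_left (by linarith)] at this
    simp only [Pi.zero_apply]; linarith

open Polynomial in
theorem ae_eq_zero_of_integral_mul_hermiteR_eq_zero {f : ℝ → ℝ}
    (hf : MemLp f 2 (gaussianReal 0 1))
    (h : ∀ j : ℕ, ∫ x, f x * (hermiteR j).eval x ∂(gaussianReal 0 1) = 0) :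
    f =ᵐ[gaussianReal 0 1] 0 := by
  have hi (p : ℝ[X]) : Integrable (fun x => f x * p.eval x) (gaussianReal 0 1) :=
    hf.integrable_mul ((PolyGrowth.eval p).memLp 1 p.continuous.measurable)
  have key : ∀ k j : ℕ, ∫ x, f x * (X ^ k * hermiteR j).eval x ∂(gaussianReal 0 1) = 0 := by
    intro k
    induction k with
    | zero => simpa using h
    | succ k ih =>
      intro j
      cases j with
      | zero =>
        have : (X ^ (k + 1) * hermiteR 0 : ℝ[X]) = X ^ k * hermiteR 1 := by
          rw [hermiteR_zero, hermiteR_one]; ring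
        rw [this]; exact ih 1
      | succ j =>
        have h1 : (fun x => f x * (X ^ (k + 1) * hermiteR (j + 1)).eval x)
            = fun x => f x * (X ^ k * hermiteR (j + 2)).eval x
              + ((j : ℝ) + 1) * (f x * (X ^ k * hermiteR j).eval x) := by
          ext x
          rw [X_pow_succ_mul_hermiteR_succ, eval_add, eval_C_mul]; ring
        rw [h1, integral_add (hi _) ((hi _).const_mul _), integral_const_mul, ih, ih]
        simp
  refine ae_eq_zero_of_integral_mul_pow_eq_zero hf fun k => ?_
  simpa [hermiteR_zero] using key k 0

/-- The orthonormal Hermite polynomials. -/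
noncomputable def hermiteN (j : ℕ) (x : ℝ) : ℝ := (hermiteR j).eval x / √(j.factorial : ℝ)

/-- The Hermite coefficients of `g`. -/
noncomputable def hermiteCoeff (g : ℝ → ℝ) (j : ℕ) : ℝ :=
  ∫ x, g x * hermiteN j x ∂(gaussianReal 0 1)

theorem hermiteCoeff_eq (g : ℝ → ℝ) (j : ℕ) : hermiteCoeff g j
    = (∫ x, g x * (hermiteR j).eval x ∂(gaussianReal 0 1)) / √(j.factorial : ℝ) := by
  simp only [hermiteCoeff, hermiteN, ← mul_div_assoc]
  exact integral_div _ _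

theorem continuous_hermiteN (j : ℕ) : Continuous (hermiteN j) :=
  (hermiteR j).continuous.div_const _

theorem polyGrowth_hermiteN (j : ℕ) : PolyGrowth (hermiteN j) := by
  have := (PolyGrowth.eval (hermiteR j)).mul (PolyGrowth.const (√(j.factorial : ℝ))⁻¹)
  simp only [← div_eq_mul_inv] at this
  exact this

theorem memLp_hermiteN (j : ℕ) : MemLp (hermiteN j) 2 (gaussianReal 0 1) :=
  (polyGrowth_hermiteN j).memLp 1 (continuous_hermiteN j).measurable

theorem abs_hermiteN_le {j : ℕ} {x : ℝ} (hx : x ^ 2 ≤ 2 * j) :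
    |hermiteN j x| ≤ 2 * Real.exp (x ^ 2 / 4) := by
  have h0 : 0 < √(j.factorial : ℝ) := Real.sqrt_pos.2 (by positivity)
  rw [hermiteN, abs_div, abs_of_pos h0, div_le_iff₀ h0]
  exact (abs_eval_hermiteR_le hx).trans_eq (by ring)

/-- The orthonormal Hermite polynomials as elements of `L²`. -/
noncomputable def hermiteLp (j : ℕ) : Lp ℝ 2 (gaussianReal 0 1) := (memLp_hermiteN j).toLp

theorem inner_hermiteLp {g : ℝ → ℝ} (hg : MemLp g 2 (gaussianReal 0 1)) (j : ℕ) :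
    inner ℝ (hermiteLp j) hg.toLp = hermiteCoeff g j := by
  rw [L2.inner_def]
  refine integral_congr_ae ?_
  filter_upwards [(memLp_hermiteN j).coeFn_toLp, hg.coeFn_toLp] with x h1 h2
  rw [hermiteLp, h1, h2]
  simp

theorem orthonormal_hermiteLp : Orthonormal ℝ hermiteLp := by
  have h (i j : ℕ) : inner ℝ (hermiteLp i) (hermiteLp j)
      = (∫ x, (hermiteR j).eval x * (hermiteR i).eval x ∂(gaussianReal 0 1))
        / √(j.factorial : ℝ) / √(i.factorial : ℝ) := by
    refine (inner_hermiteLp (memLp_hermiteN j) i).trans ?_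
    rw [hermiteCoeff_eq, ← integral_div (√(j.factorial : ℝ))]
    congr 1
    refine integral_congr_ae (ae_of_all _ fun x => ?_)
    simp only [hermiteN]; ring
  rw [orthonormal_iff_ite]
  intro i j
  rw [h]
  split_ifs with hij
  · subst hij
    rw [integral_hermiteR_sq, div_div, Real.mul_self_sqrt (by positivity), div_self (by positivity)]
  · rw [integral_hermiteR_mul_of_ne (Ne.symm hij)]; simp

theorem sum_sq_hermiteCoeff_le {g : ℝ → ℝ} (hg : MemLp g 2 (gaussianReal 0 1)) (s : Finset ℕ) :
    ∑ j ∈ s, hermiteCoeff g j ^ 2 ≤ ∫ x, g x ^ 2 ∂(gaussianReal 0 1) := by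
  have h := orthonormal_hermiteLp.sum_inner_products_le hg.toLp (s := s)
  simp only [inner_hermiteLp, Real.norm_eq_abs, sq_abs] at h
  refine h.trans_eq ?_
  rw [← real_inner_self_eq_norm_sq, L2.inner_def]
  refine integral_congr_ae ?_
  filter_upwards [hg.coeFn_toLp] with x hx
  rw [hx]
  simp [sq]

theorem orthogonal_span_hermiteLp : (Submodule.span ℝ (Set.range hermiteLp))ᗮ = ⊥ := by
  rw [Submodule.eq_bot_iff]
  intro f hf
  have hmem := Lp.memLp f
  have hcoe : hmem.toLp = f := Lp.toLp_coeFn f hmem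
  have h0 (j : ℕ) : hermiteCoeff f j = 0 := by
    rw [← inner_hermiteLp hmem, hcoe]
    exact (Submodule.mem_orthogonal _ _).1 hf _ (Submodule.subset_span ⟨j, rfl⟩)
  have hae := ae_eq_zero_of_integral_mul_hermiteR_eq_zero hmem fun j => by
    have := h0 j
    rw [hermiteCoeff_eq, div_eq_zero_iff] at this
    exact this.resolve_right (Real.sqrt_pos.2 (by positivity)).ne'
  exact (Lp.eq_zero_iff_ae_eq_zero).2 hae

/-- The Hermite series of a function in `L²` converges to it almost everywhere along a
subsequence. -/
theorem exists_seq_tendsto_hermite_sum {g : ℝ → ℝ} (hg : MemLp g 2 (gaussianReal 0 1)) :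
    ∃ ns : ℕ → ℕ, StrictMono ns ∧ ∀ᵐ x ∂(gaussianReal 0 1),
      Tendsto (fun k => ∑ j ∈ Finset.range (ns k), hermiteCoeff g j * hermiteN j x) atTop
        (𝓝 (g x)) := by
  let b := HilbertBasis.mkOfOrthogonalEqBot orthonormal_hermiteLp orthogonal_span_hermiteLp
  have hb (j : ℕ) : b j = hermiteLp j := by
    simp only [b, HilbertBasis.coe_mkOfOrthogonalEqBot]
  have hs := (b.hasSum_repr hg.toLp).tendsto_sum_nat
  simp only [b.repr_apply_apply, hb, inner_hermiteLp] at hs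
  obtain ⟨ns, hns, hlim⟩ := (tendstoInMeasure_of_tendsto_Lp hs).exists_seq_tendsto_ae
  refine ⟨ns, hns, ?_⟩
  have hS (N : ℕ) : (∑ j ∈ Finset.range N, hermiteCoeff g j • hermiteLp j
      : Lp ℝ 2 (gaussianReal 0 1)) =ᵐ[gaussianReal 0 1]
      fun x => ∑ j ∈ Finset.range N, hermiteCoeff g j * hermiteN j x := by
    induction N with
    | zero =>
      simp only [Finset.range_zero, Finset.sum_empty]
      exact Lp.coeFn_zero ℝ 2 (gaussianReal 0 1)
    | succ N ih =>
      simp only [Finset.sum_range_succ]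
      refine (Lp.coeFn_add _ _).trans ?_
      filter_upwards [ih, Lp.coeFn_smul (hermiteCoeff g N) (hermiteLp N),
        (memLp_hermiteN N).coeFn_toLp] with x h1 h2 h3
      rw [Pi.add_apply, h1, h2, Pi.smul_apply, hermiteLp, h3, smul_eq_mul]
  filter_upwards [hlim, hg.coeFn_toLp, ae_all_iff.2 hS] with x h1 h2 h3
  rw [h2] at h1
  simpa only [h3] using h1

/-- Summable coefficients and the Cramér-type bound give locally uniform convergence, so the sum is
continuous. It equals `g` almost everywhere through an `L²` subsequence, hence everywhere by
continuity. -/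
theorem tendsto_hermite_sum {g : ℝ → ℝ} (hg : MemLp g 2 (gaussianReal 0 1)) (hc : Continuous g)
    (hs : Summable (hermiteCoeff g)) (x : ℝ) :
    Tendsto (fun M => ∑ j ∈ Finset.range M, hermiteCoeff g j * hermiteN j x) atTop
      (𝓝 (g x)) := by
  have hunif (R : ℝ) : TendstoUniformlyOn
      (fun M x => ∑ j ∈ Finset.range M, hermiteCoeff g j * hermiteN j x)
      (fun x => ∑' j, hermiteCoeff g j * hermiteN j x) atTop (Metric.closedBall 0 R) := by
    refine tendstoUniformlyOn_tsum_nat_eventually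
      (u := fun j => |hermiteCoeff g j| * (2 * Real.exp (R ^ 2 / 4))) (hs.abs.mul_right _) ?_
    -- The pointwise bound needs `y² ≤ 2j`, so on a ball it is available only for large `j`.
    filter_upwards [eventually_ge_atTop ⌈R ^ 2⌉₊] with j hj y hy
    have hy' : y ^ 2 ≤ R ^ 2 := by
      rw [mem_closedBall_zero_iff, Real.norm_eq_abs] at hy
      exact sq_le_sq.2 (hy.trans (le_abs_self R))
    have hj' : R ^ 2 ≤ j := Nat.ceil_le.1 hj
    have : y ^ 2 ≤ 2 * j := by linarith [(Nat.cast_nonneg j : (0 : ℝ) ≤ j)]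
    rw [Real.norm_eq_abs, abs_mul]
    refine mul_le_mul_of_nonneg_left ((abs_hermiteN_le this).trans ?_) (abs_nonneg _)
    gcongr
  have hpt (y : ℝ) := (hunif |y|).tendsto_at (x := y) (by simp)
  have hcont : Continuous fun x => ∑' j, hermiteCoeff g j * hermiteN j x := by
    rw [continuous_iff_continuousAt]
    intro y
    have := (hunif (|y| + 1)).continuousOn (Frequently.of_forall fun M =>
      (continuous_finsetSum _ fun j _ => (continuous_hermiteN j).const_mul _).continuousOn)
    exact this.continuousAt (Metric.closedBall_mem_nhds_of_mem (by simp))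
  obtain ⟨ns, hns, hlim⟩ := exists_seq_tendsto_hermite_sum hg
  have hae : (fun x => ∑' j, hermiteCoeff g j * hermiteN j x) =ᵐ[gaussianReal 0 1] g := by
    filter_upwards [hlim] with y hy
    exact tendsto_nhds_unique ((hpt y).comp hns.tendsto_atTop) hy
  have := (Continuous.ae_eq_iff_eq volume hcont hc).1
    ((gaussianReal_absolutelyContinuous' 0 one_ne_zero).ae_le hae)
  have hx := hpt x
  rwa [congrFun this x] at hx

end Completeness

/-! ### Tempered functions -/

/-- `f` is locally Lipschitz on `J` with a polynomially growing constant. -/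
def LipPolyOn (J : Set ℝ) (f : ℝ → ℝ) : Prop :=
  ∃ C : ℝ, ∃ N : ℕ, 0 ≤ C ∧ ∀ x ∈ J, ∀ y ∈ J, |f x - f y| ≤ C * |x - y| * (1 + |x| + |y|) ^ N

/-- `f` and its derivatives of orders `1, …, m` exist on `J` and are locally Lipschitz there with
polynomially growing constants. -/
def TemperedOn (J : Set ℝ) : ℕ → (ℝ → ℝ) → Prop
  | 0, f => LipPolyOn J f
  | m + 1, f => LipPolyOn J f ∧ ∃ f' : ℝ → ℝ, (∀ x ∈ J, HasDerivAt f (f' x) x) ∧ TemperedOn J m f'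

theorem TemperedOn.lipPolyOn {J : Set ℝ} {m : ℕ} {f : ℝ → ℝ} (h : TemperedOn J m f) :
    LipPolyOn J f := by
  cases m with
  | zero => exact h
  | succ m => exact h.1

theorem LipPolyOn.polyGrowth {f : ℝ → ℝ} (h : LipPolyOn Set.univ f) : PolyGrowth f := by
  obtain ⟨C, N, hC, hf⟩ := h
  refine ⟨|f 0| + C, N + 1, by positivity, fun x => ?_⟩
  have h1 := hf x trivial 0 trivial
  simp only [sub_zero, abs_zero, add_zero] at h1
  have h2 : (1 : ℝ) ≤ (1 + |x|) ^ (N + 1) := one_le_pow₀ (by simp)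
  calc |f x| ≤ |f 0| + |f x - f 0| := by
        have := abs_add_le (f 0) (f x - f 0); simpa using this
    _ ≤ |f 0| * (1 + |x|) ^ (N + 1) + C * (1 + |x|) * (1 + |x|) ^ N := by
        refine add_le_add (le_mul_of_one_le_right (abs_nonneg _) h2) (h1.trans ?_)
        gcongr
        linarith
    _ = _ := by ring

theorem LipPolyOn.continuous {f : ℝ → ℝ} (h : LipPolyOn Set.univ f) : Continuous f := by
  obtain ⟨C, N, hC, hf⟩ := h
  rw [continuous_iff_continuousAt]
  intro x
  rw [ContinuousAt, tendsto_iff_dist_tendsto_zero]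
  have h1 : Filter.Tendsto (fun y => C * |y - x| * (1 + |y| + |x|) ^ N) (nhds x) (nhds 0) := by
    have : Continuous fun y => C * |y - x| * (1 + |y| + |x|) ^ N := by fun_prop
    simpa using this.tendsto x
  exact squeeze_zero (fun _ => dist_nonneg) (fun y => hf y trivial x trivial) h1

/-! ### Decay of Hermite coefficients -/

section CoefficientDecay
open Filter Topology Set

/-- The integrals of a function over short intervals, divided by their length. -/
noncomputable def steklov (u : ℝ → ℝ) (h x : ℝ) : ℝ := (∫ s in x..(x + h), u s) / h

theorem hasDerivAt_steklov {u : ℝ → ℝ} (hu : Continuous u) (h x : ℝ) :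
    HasDerivAt (steklov u h) ((u (x + h) - u x) / h) x := by
  have hP (y : ℝ) : HasDerivAt (fun z => ∫ s in (0 : ℝ)..z, u s) (u y) y :=
    (hu.integral_hasStrictDerivAt 0 y).hasDerivAt
  have heq : steklov u h = fun y => ((∫ s in (0 : ℝ)..(y + h), u s) - ∫ s in (0 : ℝ)..y, u s) / h := by
    ext y
    rw [steklov, intervalIntegral.integral_interval_sub_left (hu.intervalIntegrable _ _)
      (hu.intervalIntegrable _ _)]
  rw [heq]
  exact (((hP (x + h)).comp_add_const x h).sub (hP x)).div_const h

theorem one_add_abs_add_abs_le {x y : ℝ} (h : |y - x| ≤ 1) : 1 + |x| + |y| ≤ 2 * (1 + |x|) := by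
  have : |y| ≤ |x| + 1 := by
    have := abs_add_le x (y - x)
    simp only [add_sub_cancel] at this
    linarith
  linarith

theorem abs_steklov_sub_le {u : ℝ → ℝ} {C : ℝ} {N : ℕ} (hC : 0 ≤ C) (hc : Continuous u)
    (hu : ∀ x y, |u x - u y| ≤ C * |x - y| * (1 + |x| + |y|) ^ N) {h : ℝ} (h0 : 0 < h)
    (h1 : h ≤ 1) (x : ℝ) : |steklov u h x - u x| ≤ h * (C * (2 * (1 + |x|)) ^ N) := by
  have heq : steklov u h x - u x = (∫ s in x..(x + h), (u s - u x)) / h := by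
    rw [intervalIntegral.integral_sub (hc.intervalIntegrable _ _)
      (continuous_const.intervalIntegrable _ _), intervalIntegral.integral_const, steklov]
    simp only [add_sub_cancel_left, smul_eq_mul]
    field_simp
  rw [heq, abs_div, abs_of_pos h0, div_le_iff₀ h0]
  have := intervalIntegral.norm_integral_le_of_norm_le_const (a := x) (b := x + h)
    (f := fun s => u s - u x) (C := h * (C * (2 * (1 + |x|)) ^ N)) (fun s hs => by
      rw [uIoc_of_le (by linarith)] at hs
      have hs1 : |s - x| ≤ h := by rw [abs_of_pos (by linarith [hs.1])]; linarith [hs.2]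
      have hs2 := one_add_abs_add_abs_le (hs1.trans h1)
      have h3 := hu x s
      rw [Real.norm_eq_abs, abs_sub_comm]
      calc |u x - u s| ≤ C * |x - s| * (1 + |x| + |s|) ^ N := h3
        _ ≤ C * h * (2 * (1 + |x|)) ^ N := by
            rw [abs_sub_comm x s]; gcongr
        _ = _ := by ring)
  simpa [abs_of_pos h0] using this

theorem abs_diffQuot_le {u : ℝ → ℝ} {C : ℝ} {N : ℕ}
    (hu : ∀ x y, |u x - u y| ≤ C * |x - y| * (1 + |x| + |y|) ^ N) (hC : 0 ≤ C) {h : ℝ} (h0 : 0 < h)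
    (h1 : h ≤ 1) (x : ℝ) : |(u (x + h) - u x) / h| ≤ C * (2 * (1 + |x|)) ^ N := by
  rw [abs_div, abs_of_pos h0, div_le_iff₀ h0]
  have hs2 := one_add_abs_add_abs_le (x := x) (y := x + h) (by simpa [abs_of_pos h0] using h1)
  have h3 := hu x (x + h)
  rw [abs_sub_comm]
  calc |u x - u (x + h)| ≤ C * |x - (x + h)| * (1 + |x| + |x + h|) ^ N := h3
    _ ≤ C * h * (2 * (1 + |x|)) ^ N := by
        have : |x - (x + h)| = h := by simp [abs_of_pos h0]
        rw [this]; gcongr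
    _ = _ := by ring

/-- The Hermite coefficients of a function with polynomially growing Lipschitz constant are square
summable against the weight `j`. -/
theorem LipPolyOn.sum_sq_integral_mul_hermiteR_le {u : ℝ → ℝ} (hu : LipPolyOn univ u) :
    ∃ B : ℝ, 0 ≤ B ∧ ∀ s : Finset ℕ,
      ∑ i ∈ s, (∫ x, u x * (hermiteR (i + 1)).eval x ∂(gaussianReal 0 1)) ^ 2 / i.factorial
        ≤ B := by
  have hc := hu.continuous
  have hpg := hu.polyGrowth
  obtain ⟨C, N, hC, hu⟩ := hu
  have hu' : ∀ x y, |u x - u y| ≤ C * |x - y| * (1 + |x| + |y|) ^ N :=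
    fun x y => hu x trivial y trivial
  set b : ℝ → ℝ := fun x => C * (2 * (1 + |x|)) ^ N with hb
  have hbc : Continuous b := by fun_prop
  have hbg : PolyGrowth b := (PolyGrowth.const C).mul
    (((PolyGrowth.const 2).mul ((PolyGrowth.const 1).add PolyGrowth.id.abs)).pow N)
  have hb0 (x : ℝ) : 0 ≤ b x := by positivity
  have hDc (h : ℝ) : Continuous fun x => (u (x + h) - u x) / h := by fun_prop
  have hSc (h : ℝ) : Continuous (steklov u h) :=
    continuous_iff_continuousAt.2 fun x => (hasDerivAt_steklov hc h x).continuousAt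
  have hpgD {f : ℝ → ℝ} {c : ℝ} (hf : ∀ x, |f x| ≤ c * b x) : PolyGrowth f := by
    obtain ⟨D, M, hD, hg⟩ := (PolyGrowth.const c).mul hbg
    exact ⟨D, M, hD, fun x => (hf x).trans ((le_abs_self _).trans (hg x))⟩
  have hDg {h : ℝ} (h0 : 0 < h) (h1 : h ≤ 1) : PolyGrowth fun x => (u (x + h) - u x) / h :=
    hpgD (c := 1) fun x => by simpa using abs_diffQuot_le hu' hC h0 h1 x
  have hSg {h : ℝ} (h0 : 0 < h) (h1 : h ≤ 1) : PolyGrowth fun x => steklov u h x - u x :=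
    hpgD (c := h) fun x => abs_steklov_sub_le hC hc hu' h0 h1 x
  have hSg' {h : ℝ} (h0 : 0 < h) (h1 : h ≤ 1) : PolyGrowth (steklov u h) := by
    have := (hSg h0 h1).add hpg
    simpa using this
  refine ⟨∫ x, b x ^ 2 ∂(gaussianReal 0 1), integral_nonneg fun x => sq_nonneg _, fun s => ?_⟩
  -- Differentiability of `u` is not assumed, so the integration by parts is done on its Steklov
  -- mean, whose derivative is a difference quotient bounded by `b` uniformly in `h ≤ 1`. Bessel's
  -- inequality then applies, and `h → 0` recovers `u`.
  have hlim (i : ℕ) : Tendsto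
      (fun h => ∫ x, steklov u h x * (hermiteR (i + 1)).eval x ∂(gaussianReal 0 1)) (𝓝[>] 0)
      (𝓝 (∫ x, u x * (hermiteR (i + 1)).eval x ∂(gaussianReal 0 1))) := by
    set p := hermiteR (i + 1)
    have hpm : Measurable fun x => p.eval x := p.continuous.measurable
    rw [tendsto_iff_dist_tendsto_zero]
    have hK : Tendsto (fun h : ℝ => h * ∫ x, b x * |p.eval x| ∂(gaussianReal 0 1)) (𝓝[>] 0)
        (𝓝 0) := by
      have : Continuous fun h : ℝ => h * ∫ x, b x * |p.eval x| ∂(gaussianReal 0 1) := by fun_prop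
      have := this.tendsto 0
      rw [zero_mul] at this
      exact this.mono_left nhdsWithin_le_nhds
    refine squeeze_zero' (Eventually.of_forall fun _ => dist_nonneg) ?_ hK
    filter_upwards [Ioc_mem_nhdsGT one_pos] with h hh
    rw [Real.dist_eq, ← integral_sub
      (((hSg' hh.1 hh.2).mul (PolyGrowth.eval p)).integrable 1 ((hSc h).measurable.mul hpm))
      ((hpg.mul (PolyGrowth.eval p)).integrable 1 (hc.measurable.mul hpm)), ← integral_const_mul,
      ← Real.norm_eq_abs]
    refine norm_integral_le_of_norm_le (((hbg.mul (PolyGrowth.eval p).abs).integrable 1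
      (hbc.measurable.mul hpm.abs)).const_mul h) (ae_of_all _ fun x => ?_)
    rw [← sub_mul, Real.norm_eq_abs, abs_mul, ← mul_assoc]
    exact mul_le_mul_of_nonneg_right (abs_steklov_sub_le hC hc hu' hh.1 hh.2 x) (abs_nonneg _)
  refine le_of_tendsto (tendsto_finsetSum s fun i _ => ((hlim i).pow 2).div_const _) ?_
  filter_upwards [Ioc_mem_nhdsGT one_pos] with h hh
  have hD := (hDg hh.1 hh.2).memLp 1 (hDc h).measurable
  calc _ = ∑ i ∈ s, hermiteCoeff (fun x => (u (x + h) - u x) / h) i ^ 2 := by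
        refine Finset.sum_congr rfl fun i _ => ?_
        rw [integral_mul_hermiteR_succ (hSg' hh.1 hh.2) (hDg hh.1 hh.2) (hDc h).measurable
          (hasDerivAt_steklov hc h), hermiteCoeff_eq, div_pow, Real.sq_sqrt (by positivity)]
    _ ≤ ∫ x, ((u (x + h) - u x) / h) ^ 2 ∂(gaussianReal 0 1) := sum_sq_hermiteCoeff_le hD s
    _ ≤ _ := by
        refine integral_mono hD.integrable_sq
          ((hbg.pow 2).integrable 1 (hbc.pow 2).measurable) fun x => ?_
        exact sq_le_sq' (abs_le.1 (abs_diffQuot_le hu' hC hh.1 hh.2 x)).1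
          (abs_le.1 (abs_diffQuot_le hu' hC hh.1 hh.2 x)).2

theorem TemperedOn.exists_integral_mul_hermiteR {m : ℕ} {g : ℝ → ℝ} (hg : TemperedOn univ m g) :
    ∃ u, LipPolyOn univ u ∧ ∀ j, ∫ x, g x * (hermiteR (j + m)).eval x ∂(gaussianReal 0 1)
      = ∫ x, u x * (hermiteR j).eval x ∂(gaussianReal 0 1) := by
  induction m generalizing g with
  | zero => exact ⟨g, hg, fun j => rfl⟩
  | succ m ih =>
    obtain ⟨hl, g', hd, hg'⟩ := hg
    obtain ⟨u, hu, h⟩ := ih hg'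
    refine ⟨u, hu, fun j => ?_⟩
    rw [← h j, ← add_assoc]
    exact integral_mul_hermiteR_succ hl.polyGrowth hg'.lipPolyOn.polyGrowth
      hg'.lipPolyOn.continuous.measurable (fun x => hd x trivial) _

theorem sum_Ico_inv_pow_le {m n : ℕ} (hm : 1 ≤ m) (hn : 1 ≤ n) (M : ℕ) :
    ∑ i ∈ Finset.Ico n M, (((i : ℝ) + 1) ^ (m + 1))⁻¹ ≤ 2 * ((n : ℝ) ^ m)⁻¹ := by
  obtain ⟨k, rfl⟩ := Nat.exists_eq_add_of_le' hm
  have hn' : (0 : ℝ) < n := by exact_mod_cast hn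
  have h1 : ∑ i ∈ Finset.Ico n M, (((i : ℝ) + 1) ^ 2)⁻¹ ≤ 2 * (n : ℝ)⁻¹ := by
    have h := sum_Ioo_inv_sq_le (α := ℝ) n (M + 1)
    have h2 : Finset.Ioo n (M + 1) = Finset.Ico (n + 1) (M + 1) := by
      ext; simp only [Finset.mem_Ioo, Finset.mem_Ico]; omega
    rw [h2, ← Finset.sum_Ico_add'] at h
    push_cast at h
    refine h.trans ?_
    rw [div_eq_mul_inv]
    gcongr
    linarith
  calc ∑ i ∈ Finset.Ico n M, (((i : ℝ) + 1) ^ (k + 1 + 1))⁻¹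
      ≤ ∑ i ∈ Finset.Ico n M, ((n : ℝ) ^ k)⁻¹ * (((i : ℝ) + 1) ^ 2)⁻¹ := by
        refine Finset.sum_le_sum fun i hi => ?_
        rw [Finset.mem_Ico] at hi
        have : (n : ℝ) ≤ (i : ℝ) + 1 := by
          have : (n : ℝ) ≤ i := by exact_mod_cast hi.1
          linarith
        rw [← mul_inv, add_assoc, pow_add]
        gcongr
    _ = ((n : ℝ) ^ k)⁻¹ * ∑ i ∈ Finset.Ico n M, (((i : ℝ) + 1) ^ 2)⁻¹ := by rw [Finset.mul_sum]
    _ ≤ ((n : ℝ) ^ k)⁻¹ * (2 * (n : ℝ)⁻¹) := by gcongr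
    _ = _ := by rw [pow_succ, mul_inv]; ring

/-- Cauchy–Schwarz between the square-summable coefficients gained after `m + 1` integrations by
parts and the tail of `∑ (i+1)^(-(m+1))`. The latter is `O(n^(-m))` only for `m ≥ 1`. -/
theorem TemperedOn.sum_abs_hermiteCoeff_le {m : ℕ} (hm : 1 ≤ m) {g : ℝ → ℝ}
    (hg : TemperedOn univ m g) :
    ∃ B : ℝ, 0 ≤ B ∧ ∀ n M : ℕ, 1 ≤ n →
      ∑ i ∈ Finset.Ico n M, |hermiteCoeff g (i + (m + 1))| ≤ B * (n : ℝ) ^ (-(m : ℝ) / 2) := by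
  obtain ⟨u, hu, hgu⟩ := hg.exists_integral_mul_hermiteR
  obtain ⟨B, hB, h⟩ := hu.sum_sq_integral_mul_hermiteR_le
  refine ⟨√(2 * B), Real.sqrt_nonneg _, fun n M hn => ?_⟩
  have hn' : (0 : ℝ) < n := by exact_mod_cast hn
  set c : ℕ → ℝ := fun i => ∫ x, u x * (hermiteR (i + 1)).eval x ∂(gaussianReal 0 1) with hc
  have hcoef (i : ℕ) : |hermiteCoeff g (i + (m + 1))|
      ≤ |c i / √(i.factorial : ℝ)| * √(((i : ℝ) + 1) ^ (m + 1))⁻¹ := by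
    have h1 : i + (m + 1) = i + 1 + m := by ring
    -- Normalising by `√(i+m+1)!` instead of `√i!` is what produces the decay.
    have hf : (i.factorial : ℝ) * ((i : ℝ) + 1) ^ (m + 1) ≤ (i + (m + 1)).factorial := by
      exact_mod_cast Nat.factorial_mul_pow_le_factorial
    rw [hermiteCoeff_eq, h1, hgu, abs_div, abs_div, ← h1, abs_of_nonneg (Real.sqrt_nonneg _),
      abs_of_nonneg (Real.sqrt_nonneg _), Real.sqrt_inv, div_eq_mul_inv, div_eq_mul_inv, mul_assoc,
      ← mul_inv, ← Real.sqrt_mul (by positivity)]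
    gcongr
  have hcs := Finset.sum_mul_sq_le_sq_mul_sq (Finset.Ico n M)
    (fun i => |c i / √(i.factorial : ℝ)|) (fun i => √(((i : ℝ) + 1) ^ (m + 1))⁻¹)
  have h1 : ∑ i ∈ Finset.Ico n M, |c i / √(i.factorial : ℝ)| ^ 2 ≤ B := by
    refine le_trans (le_of_eq (Finset.sum_congr rfl fun i _ => ?_)) (h (Finset.Ico n M))
    rw [sq_abs, div_pow, Real.sq_sqrt (by positivity)]
  have h2 : ∑ i ∈ Finset.Ico n M, √(((i : ℝ) + 1) ^ (m + 1))⁻¹ ^ 2 ≤ 2 * ((n : ℝ) ^ m)⁻¹ := by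
    refine le_trans (le_of_eq (Finset.sum_congr rfl fun i _ => ?_)) (sum_Ico_inv_pow_le hm hn M)
    rw [Real.sq_sqrt (by positivity)]
  have hpow : (n : ℝ) ^ (-(m : ℝ) / 2) = √((n : ℝ) ^ m)⁻¹ := by
    rw [Real.sqrt_eq_rpow, ← Real.rpow_natCast, ← Real.rpow_neg hn'.le, ← Real.rpow_mul hn'.le]
    congr 1; ring
  refine (Finset.sum_le_sum fun i _ => hcoef i).trans ?_
  rw [hpow, ← Real.sqrt_mul (by positivity)]
  refine Real.le_sqrt_of_sq_le (hcs.trans ?_)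
  calc _ ≤ B * (2 * ((n : ℝ) ^ m)⁻¹) :=
        mul_le_mul h1 h2 (Finset.sum_nonneg fun i _ => sq_nonneg _) hB
    _ = _ := by ring

theorem TemperedOn.summable_hermiteCoeff {m : ℕ} (hm : 1 ≤ m) {g : ℝ → ℝ}
    (hg : TemperedOn univ m g) : Summable (hermiteCoeff g) := by
  obtain ⟨B, hB, h⟩ := hg.sum_abs_hermiteCoeff_le hm
  have h1 : Summable fun i => |hermiteCoeff g (i + (m + 1) + 1)| := by
    refine summable_of_sum_range_le (c := B) (fun i => abs_nonneg _) fun M => ?_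
    have := h 1 (M + 1) le_rfl
    rw [Nat.cast_one, Real.one_rpow, mul_one, Finset.sum_Ico_eq_sum_range, Nat.add_sub_cancel] at this
    refine le_trans (le_of_eq (Finset.sum_congr rfl fun i _ => ?_)) this
    congr 2; ring
  exact (summable_nat_add_iff (f := hermiteCoeff g) (m + 1 + 1)).1 h1.of_abs

/-! ### Quadrature error for tempered functions -/

theorem gaussHermite_hermiteN_of_lt {j n : ℕ} (hj : j < 2 * n) :
    gaussHermite n 1 (hermiteN j) = if j = 0 then 1 else 0 := by
  have h1 : hermiteN j = fun x => (√(j.factorial : ℝ))⁻¹ * (hermiteR j).eval x := by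
    ext x; rw [hermiteN, div_eq_inv_mul]
  rw [h1, gaussHermite_const_mul,
    gaussHermite_eval_of_natDegree_lt (by rwa [natDegree_hermiteR])]
  split_ifs with h
  · subst h; simp [hermiteR_zero]
  · have := integral_eval_mul_hermiteR_of_natDegree_lt (p := 1) (n := j)
      (by rw [Polynomial.natDegree_one]; omega)
    simp only [Polynomial.eval_one, one_mul] at this
    rw [this, mul_zero]

/-- Every node has `x² < 4n ≤ 2j`, so the Cramér-type bound holds at all nodes; positivity of the
weights and `gaussHermite_exp_le` finish. -/
theorem abs_gaussHermite_hermiteN_le {j n : ℕ} (hj : 2 * n ≤ j) :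
    |gaussHermite n 1 (hermiteN j)| ≤ 2 * ∫ x, Real.exp (x ^ 2 / 4) ∂(gaussianReal 0 1) := by
  have h1 := abs_gaussHermite_one_le (n := n) (f := hermiteN j)
    (g := fun x => 2 * Real.exp (x ^ 2 / 4)) fun x hx => abs_hermiteN_le (by
      have := sq_lt_of_mem_hermiteNodes hx
      have : (2 * n : ℝ) ≤ j := by exact_mod_cast hj
      linarith)
  rw [gaussHermite_const_mul] at h1
  linarith [gaussHermite_exp_le n]

theorem tendsto_gaussHermite {n : ℕ} {f : ℕ → ℝ → ℝ} {g : ℝ → ℝ}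
    (h : ∀ x, Tendsto (fun M => f M x) atTop (𝓝 (g x))) :
    Tendsto (fun M => gaussHermite n 1 (f M)) atTop (𝓝 (gaussHermite n 1 g)) := by
  simp only [gaussHermite_one]
  exact tendsto_finsetSum _ fun x _ => (h x).const_mul _

theorem hermiteCoeff_zero (g : ℝ → ℝ) : hermiteCoeff g 0 = ∫ x, g x ∂(gaussianReal 0 1) := by
  simp [hermiteCoeff, hermiteN, hermiteR_zero]

theorem TemperedOn.abs_gaussHermite_sub_le {m : ℕ} (hm : 1 ≤ m) {g : ℝ → ℝ}
    (hg : TemperedOn univ m g) :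
    ∃ B : ℝ, ∀ n : ℕ, m + 1 ≤ n →
      |gaussHermite n 1 g - ∫ x, g x ∂(gaussianReal 0 1)| ≤ B * (n : ℝ) ^ (-(m : ℝ) / 2) := by
  obtain ⟨B, hB, h⟩ := hg.sum_abs_hermiteCoeff_le hm
  set K := 2 * ∫ x, Real.exp (x ^ 2 / 4) ∂(gaussianReal 0 1) with hK
  have hK0 : 0 ≤ K := mul_nonneg zero_le_two (integral_nonneg fun x => (Real.exp_pos _).le)
  refine ⟨K * B, fun n hn => ?_⟩
  have hlim := tendsto_gaussHermite (n := n) (tendsto_hermite_sum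
    (hg.lipPolyOn.polyGrowth.memLp 1 hg.lipPolyOn.continuous.measurable)
    hg.lipPolyOn.continuous (hg.summable_hermiteCoeff hm))
  refine le_of_tendsto ((hlim.sub_const _).abs) ?_
  filter_upwards [eventually_ge_atTop (2 * n)] with M hM
  rw [gaussHermite_sum]
  simp only [gaussHermite_const_mul]
  rw [← Finset.sum_range_add_sum_Ico _ hM]
  have h1 : ∑ j ∈ Finset.range (2 * n), hermiteCoeff g j * gaussHermite n 1 (hermiteN j)
      = ∫ x, g x ∂(gaussianReal 0 1) := by
    rw [Finset.sum_eq_single_of_mem 0 (by simp; omega), gaussHermite_hermiteN_of_lt (by omega),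
      if_pos rfl, mul_one, hermiteCoeff_zero]
    intro j hj hj0
    rw [gaussHermite_hermiteN_of_lt (by simpa using hj), if_neg hj0, mul_zero]
  rw [h1, add_sub_cancel_left]
  calc |∑ j ∈ Finset.Ico (2 * n) M, hermiteCoeff g j * gaussHermite n 1 (hermiteN j)|
      ≤ ∑ j ∈ Finset.Ico (2 * n) M, |hermiteCoeff g j| * K := by
        refine (Finset.abs_sum_le_sum_abs _ _).trans (Finset.sum_le_sum fun j hj => ?_)
        rw [abs_mul]
        exact mul_le_mul_of_nonneg_left
          (abs_gaussHermite_hermiteN_le (Finset.mem_Ico.1 hj).1) (abs_nonneg _)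
    _ = K * ∑ j ∈ Finset.Ico (2 * n) M, |hermiteCoeff g j| := by
        rw [← Finset.sum_mul, mul_comm]
    -- The assumption `m + 1 ≤ n` gives `n + (m + 1) ≤ 2n`, so the tail from `2n` lies in the
    -- shifted range of the coefficient estimate.
    _ ≤ K * ∑ j ∈ Finset.Ico (n + (m + 1)) (M + (m + 1)), |hermiteCoeff g j| := by
        refine mul_le_mul_of_nonneg_left
          (Finset.sum_le_sum_of_subset_of_nonneg (fun j hj => ?_) fun _ _ _ => abs_nonneg _) hK0
        rw [Finset.mem_Ico] at hj ⊢
        omega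
    _ = K * ∑ i ∈ Finset.Ico n M, |hermiteCoeff g (i + (m + 1))| := by
        rw [← Finset.sum_Ico_add' (fun j => |hermiteCoeff g j|)]
    _ ≤ K * (B * (n : ℝ) ^ (-(m : ℝ) / 2)) := by
        exact mul_le_mul_of_nonneg_left (h n M (by omega)) hK0
    _ = _ := by ring

theorem PolyGrowth.abs_le_exp {g : ℝ → ℝ} (hg : PolyGrowth g) :
    ∃ C : ℝ, ∀ x, |g x| ≤ C * Real.exp (x ^ 2 / 4) := by
  obtain ⟨C, N, hC, h⟩ := hg
  refine ⟨C * (N.factorial * Real.exp 2), fun x => (h x).trans ?_⟩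
  rw [mul_assoc]
  refine mul_le_mul_of_nonneg_left ?_ hC
  have h1 := Real.pow_div_factorial_le_exp (1 + |x|) (by positivity) N
  rw [div_le_iff₀ (by positivity)] at h1
  refine h1.trans ?_
  rw [mul_comm, mul_assoc, ← Real.exp_add]
  refine mul_le_mul_of_nonneg_left (Real.exp_le_exp.2 ?_) (by positivity)
  -- The constant `exp 2` comes from `1 + |x| ≤ 2 + x²/4`, that is, `(|x| - 2)² ≥ 0`.
  nlinarith [sq_nonneg (|x| - 2), sq_abs x]

theorem PolyGrowth.abs_gaussHermite_sub_le {g : ℝ → ℝ} (hg : PolyGrowth g) :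
    ∃ B : ℝ, ∀ n : ℕ, |gaussHermite n 1 g - ∫ x, g x ∂(gaussianReal 0 1)| ≤ B := by
  obtain ⟨C, h⟩ := hg.abs_le_exp
  have hC : 0 ≤ C := by
    have := (abs_nonneg _).trans (h 0)
    simpa using this
  refine ⟨C * (∫ x, Real.exp (x ^ 2 / 4) ∂(gaussianReal 0 1)) + |∫ x, g x ∂(gaussianReal 0 1)|,
    fun n => (abs_sub _ _).trans (add_le_add_left ?_ _)⟩
  refine (abs_gaussHermite_one_le fun x _ => h x).trans ?_
  rw [gaussHermite_const_mul]
  exact mul_le_mul_of_nonneg_left (gaussHermite_exp_le n) hC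

theorem TemperedOn.gaussHermite_sub_isBigO {m : ℕ} {g : ℝ → ℝ} (hg : TemperedOn univ m g) :
    (fun n : ℕ => gaussHermite n 1 g - ∫ x, g x ∂(gaussianReal 0 1))
      =O[atTop] fun n : ℕ => (n : ℝ) ^ (-(m : ℝ) / 2) := by
  -- For `m = 0` the coefficient estimate is unavailable, but only boundedness of the error is
  -- claimed, and polynomial growth suffices.
  rcases Nat.eq_zero_or_pos m with rfl | hm
  · obtain ⟨B, hB⟩ := hg.lipPolyOn.polyGrowth.abs_gaussHermite_sub_le
    refine IsBigO.of_bound B (Eventually.of_forall fun n => ?_)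
    simpa using hB n
  · obtain ⟨B, hB⟩ := hg.abs_gaussHermite_sub_le hm
    refine IsBigO.of_bound B ?_
    filter_upwards [eventually_ge_atTop (m + 1)] with n hn
    rw [Real.norm_eq_abs, Real.norm_of_nonneg (by positivity)]
    exact hB n hn

end CoefficientDecay

/-! ### Splines are tempered; stability of the tempered class -/

section Closure
open Filter Topology Set

theorem LipPolyOn.mono {J K : Set ℝ} {f : ℝ → ℝ} (h : LipPolyOn J f) (hK : K ⊆ J) :
    LipPolyOn K f := by
  obtain ⟨C, N, hC, hf⟩ := h
  exact ⟨C, N, hC, fun x hx y hy => hf x (hK hx) y (hK hy)⟩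

theorem one_le_one_add_abs (x y : ℝ) : 1 ≤ 1 + |x| + |y| := by
  have := abs_nonneg x; have := abs_nonneg y; linarith

theorem LipPolyOn.add {J : Set ℝ} {f g : ℝ → ℝ} (hf : LipPolyOn J f) (hg : LipPolyOn J g) :
    LipPolyOn J fun x => f x + g x := by
  obtain ⟨C, N, hC, hf⟩ := hf
  obtain ⟨D, M, hD, hg⟩ := hg
  refine ⟨C + D, N + M, by positivity, fun x hx y hy => ?_⟩
  have h1 := one_le_one_add_abs x y
  have h2 : (1 + |x| + |y|) ^ N ≤ (1 + |x| + |y|) ^ (N + M) := pow_le_pow_right₀ h1 (by omega)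
  have h3 : (1 + |x| + |y|) ^ M ≤ (1 + |x| + |y|) ^ (N + M) := pow_le_pow_right₀ h1 (by omega)
  calc |f x + g x - (f y + g y)| = |(f x - f y) + (g x - g y)| := by ring_nf
    _ ≤ C * |x - y| * (1 + |x| + |y|) ^ N + D * |x - y| * (1 + |x| + |y|) ^ M :=
      (abs_add_le _ _).trans (add_le_add (hf x hx y hy) (hg x hx y hy))
    _ ≤ C * |x - y| * (1 + |x| + |y|) ^ (N + M) + D * |x - y| * (1 + |x| + |y|) ^ (N + M) := by
      gcongr
    _ = _ := by ring

theorem LipPolyOn.mul {f g : ℝ → ℝ} (hf : LipPolyOn univ f) (hg : LipPolyOn univ g) :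
    LipPolyOn univ fun x => f x * g x := by
  obtain ⟨A, P, hA, hfg⟩ := hf.polyGrowth
  obtain ⟨B, Q, hB, hgg⟩ := hg.polyGrowth
  obtain ⟨C, N, hC, hf⟩ := hf
  obtain ⟨D, M, hD, hg⟩ := hg
  refine ⟨C * B + A * D, N + Q + P + M, by positivity, fun x hx y hy => ?_⟩
  have h1 := one_le_one_add_abs x y
  set t := 1 + |x| + |y| with ht
  have ht0 : 0 ≤ t := zero_le_one.trans h1
  have hx1 : 1 + |x| ≤ t := by rw [ht]; have := abs_nonneg y; linarith
  have hy1 : 1 + |y| ≤ t := by rw [ht]; have := abs_nonneg x; linarith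
  have h2 : t ^ N * t ^ Q ≤ t ^ (N + Q + P + M) := by
    rw [← pow_add]; exact pow_le_pow_right₀ h1 (by omega)
  have h3 : t ^ P * t ^ M ≤ t ^ (N + Q + P + M) := by
    rw [← pow_add]; exact pow_le_pow_right₀ h1 (by omega)
  calc |f x * g x - f y * g y| = |(f x - f y) * g x + f y * (g x - g y)| := by ring_nf
    _ ≤ |f x - f y| * |g x| + |f y| * |g x - g y| := by
      rw [← abs_mul, ← abs_mul]; exact abs_add_le _ _
    _ ≤ (C * |x - y| * t ^ N) * (B * t ^ Q) + (A * t ^ P) * (D * |x - y| * t ^ M) := by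
      refine add_le_add (mul_le_mul (hf x hx y hy) ((hgg x).trans ?_) (abs_nonneg _)
        (by positivity)) (mul_le_mul ((hfg y).trans ?_) (hg x hx y hy) (abs_nonneg _)
        (by positivity))
      · gcongr
      · gcongr
    _ = C * B * |x - y| * (t ^ N * t ^ Q) + A * D * |x - y| * (t ^ P * t ^ M) := by ring
    _ ≤ C * B * |x - y| * t ^ (N + Q + P + M) + A * D * |x - y| * t ^ (N + Q + P + M) := by
      gcongr
    _ = _ := by ring

theorem LipPolyOn.comp {J : Set ℝ} {f G : ℝ → ℝ} (hf : LipPolyOn J f) (hG : LipPolyOn univ G)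
    (hJ : ∀ x, G x ∈ J) : LipPolyOn univ fun x => f (G x) := by
  obtain ⟨A, P, hA, hGg⟩ := hG.polyGrowth
  obtain ⟨C, N, hC, hf⟩ := hf
  obtain ⟨D, M, hD, hG⟩ := hG
  refine ⟨C * D * (1 + 2 * A) ^ N, M + P * N, by positivity, fun x hx y hy => ?_⟩
  have h1 := one_le_one_add_abs x y
  set t := 1 + |x| + |y| with ht
  have ht0 : 0 ≤ t := zero_le_one.trans h1
  have hx1 : 1 + |x| ≤ t := by rw [ht]; have := abs_nonneg y; linarith
  have hy1 : 1 + |y| ≤ t := by rw [ht]; have := abs_nonneg x; linarith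
  have hGx : |G x| ≤ A * t ^ P := (hGg x).trans (by gcongr)
  have hGy : |G y| ≤ A * t ^ P := (hGg y).trans (by gcongr)
  have ht1 : 1 ≤ t ^ P := one_le_pow₀ h1
  calc |f (G x) - f (G y)| ≤ C * |G x - G y| * (1 + |G x| + |G y|) ^ N := hf _ (hJ x) _ (hJ y)
    _ ≤ C * (D * |x - y| * t ^ M) * ((1 + 2 * A) * t ^ P) ^ N := by
      gcongr
      · exact hG x hx y hy
      · nlinarith
    _ = _ := by rw [mul_pow, pow_add, pow_mul]; ring

theorem lipPolyOn_affine (J : Set ℝ) (a b : ℝ) : LipPolyOn J fun x => a + b * x := by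
  refine ⟨|b|, 0, abs_nonneg b, fun x _ y _ => ?_⟩
  rw [pow_zero, mul_one, ← abs_mul]
  exact le_of_eq (by congr 1; ring)

theorem lipPolyOn_eval (J : Set ℝ) (p : Polynomial ℝ) : LipPolyOn J fun x => p.eval x := by
  refine LipPolyOn.mono ?_ (subset_univ J)
  induction p using Polynomial.induction_on' with
  | add p q hp hq => simpa using hp.add hq
  | monomial n a =>
    simp only [Polynomial.eval_monomial]
    induction n with
    | zero => simpa using lipPolyOn_affine univ a 0
    | succ n ih =>
      have h := ih.mul (lipPolyOn_affine univ 0 1)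
      simp only [zero_add, one_mul, mul_assoc, ← pow_succ] at h
      exact h

theorem LipPolyOn.congr {J : Set ℝ} {f g : ℝ → ℝ} (h : LipPolyOn J f) (hfg : ∀ x ∈ J, g x = f x) :
    LipPolyOn J g := by
  obtain ⟨C, N, hC, hf⟩ := h
  exact ⟨C, N, hC, fun x hx y hy => by rw [hfg x hx, hfg y hy]; exact hf x hx y hy⟩

theorem LipPolyOn.of_subset_closure {S T : Set ℝ} {f : ℝ → ℝ} (h : LipPolyOn S f)
    (hc : ContinuousOn f T) (hST : S ⊆ T) (hT : T ⊆ closure S) : LipPolyOn T f := by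
  obtain ⟨C, N, hC, hf⟩ := h
  refine ⟨C, N, hC, fun x hx y hy => ?_⟩
  have := mem_closure_iff_nhdsWithin_neBot.1 (hT hx)
  have := mem_closure_iff_nhdsWithin_neBot.1 (hT hy)
  have h1 : Tendsto (fun p : ℝ × ℝ => |f p.1 - f p.2|) (𝓝[S] x ×ˢ 𝓝[S] y) (𝓝 |f x - f y|) :=
    (((hc x hx).mono hST).tendsto.comp tendsto_fst |>.sub
      (((hc y hy).mono hST).tendsto.comp tendsto_snd)).abs
  have h2 : Tendsto (fun p : ℝ × ℝ => C * |p.1 - p.2| * (1 + |p.1| + |p.2|) ^ N)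
      (𝓝[S] x ×ˢ 𝓝[S] y) (𝓝 (C * |x - y| * (1 + |x| + |y|) ^ N)) := by
    have hcont : Continuous fun p : ℝ × ℝ => C * |p.1 - p.2| * (1 + |p.1| + |p.2|) ^ N := by
      fun_prop
    refine (hcont.tendsto (x, y)).mono_left ?_
    rw [nhds_prod_eq]
    exact Filter.prod_mono nhdsWithin_le_nhds nhdsWithin_le_nhds
  refine le_of_tendsto_of_tendsto h1 h2 ?_
  filter_upwards [prod_mem_prod self_mem_nhdsWithin self_mem_nhdsWithin] with p hp
  exact hf _ hp.1 _ hp.2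

/-- For `x ≤ a ≤ y`, go through `f a`; the lengths `|x - a|` and `|a - y|` add up to `|x - y|`. The
powers of `1 + |a|` in `E` absorb the replacement of an endpoint by `a`. -/
theorem LipPolyOn.glue {J : Set ℝ} {f : ℝ → ℝ} {a : ℝ} (ha : a ∈ J)
    (h1 : LipPolyOn (J ∩ Iic a) f) (h2 : LipPolyOn (J ∩ Ici a) f) : LipPolyOn J f := by
  obtain ⟨C, N, hC, h1⟩ := h1
  obtain ⟨D, M, hD, h2⟩ := h2
  set E := C * (1 + |a|) ^ N + D * (1 + |a|) ^ M with hE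
  have hE0 : 0 ≤ E := by positivity
  have ha1 : 1 ≤ 1 + |a| := by simp
  have left {x y : ℝ} (hx : x ∈ J ∩ Iic a) (hy : y ∈ J ∩ Iic a) {t : ℝ}
      (ht : 1 + |x| + |y| ≤ (1 + |a|) * t) (h1t : 1 ≤ t) :
      |f x - f y| ≤ E * |x - y| * t ^ (N + M) := by
    have hp := one_le_one_add_abs x y
    calc |f x - f y| ≤ C * |x - y| * (1 + |x| + |y|) ^ N := h1 x hx y hy
      _ ≤ C * |x - y| * ((1 + |a|) * t) ^ N := by gcongr
      _ = C * (1 + |a|) ^ N * |x - y| * t ^ N := by rw [mul_pow]; ring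
      _ ≤ E * |x - y| * t ^ (N + M) := by
        have : t ^ N ≤ t ^ (N + M) := pow_le_pow_right₀ h1t (by omega)
        gcongr
        rw [hE]
        exact le_add_of_nonneg_right (by positivity)
  have right {x y : ℝ} (hx : x ∈ J ∩ Ici a) (hy : y ∈ J ∩ Ici a) {t : ℝ}
      (ht : 1 + |x| + |y| ≤ (1 + |a|) * t) (h1t : 1 ≤ t) :
      |f x - f y| ≤ E * |x - y| * t ^ (N + M) := by
    have hp := one_le_one_add_abs x y
    calc |f x - f y| ≤ D * |x - y| * (1 + |x| + |y|) ^ M := h2 x hx y hy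
      _ ≤ D * |x - y| * ((1 + |a|) * t) ^ M := by gcongr
      _ = D * (1 + |a|) ^ M * |x - y| * t ^ M := by rw [mul_pow]; ring
      _ ≤ E * |x - y| * t ^ (N + M) := by
        have : t ^ M ≤ t ^ (N + M) := pow_le_pow_right₀ h1t (by omega)
        gcongr
        rw [hE]
        exact le_add_of_nonneg_left (by positivity)
  have key {x y : ℝ} (hx : x ∈ J) (hy : y ∈ J) (hxy : x ≤ y) :
      |f x - f y| ≤ E * |x - y| * (1 + |x| + |y|) ^ (N + M) := by
    have h1t := one_le_one_add_abs x y
    have h0x := abs_nonneg x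
    have h0y := abs_nonneg y
    have h0a := abs_nonneg a
    rcases le_total y a with hya | hya
    · exact left ⟨hx, hxy.trans hya⟩ ⟨hy, hya⟩ (by nlinarith) h1t
    rcases le_total x a with hxa | hxa
    · have l := left ⟨hx, hxa⟩ ⟨ha, le_refl a⟩ (t := 1 + |x| + |y|) (by nlinarith) h1t
      have r := right ⟨ha, le_refl a⟩ ⟨hy, hya⟩ (t := 1 + |x| + |y|) (by nlinarith) h1t
      have hsum : |x - y| = |x - a| + |a - y| := by
        rw [abs_of_nonpos (by linarith), abs_of_nonpos (by linarith), abs_of_nonpos (by linarith)]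
        ring
      calc |f x - f y| ≤ |f x - f a| + |f a - f y| := abs_sub_le _ _ _
        _ ≤ _ := add_le_add l r
        _ = _ := by rw [hsum]; ring
    · exact right ⟨hx, hxa⟩ ⟨hy, hya⟩ (by nlinarith) h1t
  refine ⟨E, N + M, hE0, fun x hx y hy => ?_⟩
  rcases le_total x y with hxy | hxy
  · exact key hx hy hxy
  · rw [abs_sub_comm, abs_sub_comm x y, add_right_comm]
    exact key hy hx hxy

/-- Induction on knots: cut `J` at a knot, apply the hypothesis to the two open halves, extend each
estimate to the knot by continuity, and glue. On `(0,1)` this also controls behaviour at the ends,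
where polynomial pieces cannot blow up. -/
theorem lipPolyOn_of_piecewise {f : ℝ → ℝ} (K : Finset ℝ) : ∀ {J : Set ℝ}, IsOpen J →
    J.OrdConnected → ContinuousOn f J →
    (∀ I : Set ℝ, I.OrdConnected → I ⊆ J → Disjoint I (K : Set ℝ) →
      ∃ p : Polynomial ℝ, ∀ x ∈ I, f x = p.eval x) → LipPolyOn J f := by
  induction K using Finset.induction_on with
  | empty =>
    intro J _ hJ _ h
    obtain ⟨p, hp⟩ := h J hJ subset_rfl (by simp)
    exact (lipPolyOn_eval J p).congr hp
  | insert a K _ ih =>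
    intro J ho hJ hc h
    by_cases ha : a ∈ J
    · have hsub {S : Set ℝ} (hS : a ∉ S) (I : Set ℝ) (hI : I.OrdConnected) (hIS : I ⊆ J ∩ S)
          (hd : Disjoint I (K : Set ℝ)) : ∃ p : Polynomial ℝ, ∀ x ∈ I, f x = p.eval x := by
        refine h I hI (hIS.trans inter_subset_left) ?_
        rw [Finset.coe_insert, disjoint_insert_right]
        exact ⟨fun haI => hS (hIS haI).2, hd⟩
      have hl := ih (ho.inter isOpen_Iio) (hJ.inter ordConnected_Iio) (hc.mono inter_subset_left)
        (hsub (S := Iio a) (lt_irrefl a))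
      have hr := ih (ho.inter isOpen_Ioi) (hJ.inter ordConnected_Ioi) (hc.mono inter_subset_left)
        (hsub (S := Ioi a) (lt_irrefl a))
      have hnh := ho.mem_nhds ha
      refine LipPolyOn.glue ha
        (hl.of_subset_closure (hc.mono inter_subset_left)
          (inter_subset_inter_right _ Iio_subset_Iic_self) ?_)
        (hr.of_subset_closure (hc.mono inter_subset_left)
          (inter_subset_inter_right _ Ioi_subset_Ici_self) ?_)
      · rintro x ⟨hxJ, hxa⟩
        rcases (mem_Iic.1 hxa).eq_or_lt with rfl | hlt
        · rw [mem_closure_iff_nhdsWithin_neBot, inter_comm,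
            nhdsWithin_inter_of_mem' (mem_nhdsWithin_of_mem_nhds hnh)]
          infer_instance
        · exact subset_closure ⟨hxJ, hlt⟩
      · rintro x ⟨hxJ, hxa⟩
        rcases (mem_Ici.1 hxa).eq_or_lt with rfl | hlt
        · rw [mem_closure_iff_nhdsWithin_neBot, inter_comm,
            nhdsWithin_inter_of_mem' (mem_nhdsWithin_of_mem_nhds hnh)]
          infer_instance
        · exact subset_closure ⟨hxJ, hlt⟩
    · refine ih ho hJ hc fun I hI hIJ hd => h I hI hIJ ?_
      rw [Finset.coe_insert, disjoint_insert_right]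
      exact ⟨fun haI => ha (hIJ haI), hd⟩

theorem IsPiecewisePolynomialOn.deriv {f : ℝ → ℝ} {J : Set ℝ} (h : IsPiecewisePolynomialOn f J)
    (hd : ∀ x ∈ J, DifferentiableAt ℝ f x) : IsPiecewisePolynomialOn (deriv f) J := by
  obtain ⟨K, h⟩ := h
  refine ⟨K, fun I hI hIJ hIK => ?_⟩
  rcases I.subsingleton_or_nontrivial with hs | ⟨a, ha, b, hb, hab⟩
  -- A single point carries no information on the derivative, so the constant polynomial is used
  -- there. On a nontrivial interval, endpoints included, the derivative within the interval is
  -- unique.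
  · rcases hs.eq_empty_or_singleton with rfl | ⟨a, rfl⟩
    · exact ⟨0, by simp⟩
    · exact ⟨Polynomial.C (_root_.deriv f a), by simp⟩
  · obtain ⟨p, hp⟩ := h I hI hIJ hIK
    have hint : (interior I).Nonempty := by
      have key {a b : ℝ} (ha : a ∈ I) (hb : b ∈ I) (hlt : a < b) : (interior I).Nonempty :=
        (nonempty_Ioo.2 hlt).mono
          (interior_maximal (Ioo_subset_Icc_self.trans (hI.out ha hb)) isOpen_Ioo)
      rcases lt_or_gt_of_ne hab with hlt | hlt
      · exact key ha hb hlt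
      · exact key hb ha hlt
    refine ⟨Polynomial.derivative p, fun x hx => ?_⟩
    have hu := uniqueDiffOn_convex hI.convex hint x hx
    exact hu.eq_deriv I (hd x (hIJ hx)).hasDerivAt.hasDerivWithinAt
      ((p.hasDerivAt x).hasDerivWithinAt.congr hp (hp x hx))

theorem IsSplineOn.temperedOn {m : ℕ} {f : ℝ → ℝ} {J : Set ℝ} (h : IsSplineOn m f J)
    (ho : IsOpen J) (hJ : J.OrdConnected) : TemperedOn J m f := by
  obtain ⟨hc, hp⟩ := h
  have hl : LipPolyOn J f := by
    obtain ⟨K, hK⟩ := hp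
    exact lipPolyOn_of_piecewise K ho hJ hc.continuousOn hK
  induction m generalizing f with
  | zero => exact hl
  | succ m ih =>
    push_cast at hc
    rw [contDiffOn_succ_iff_deriv_of_isOpen ho] at hc
    have hd (x : ℝ) (hx : x ∈ J) : DifferentiableAt ℝ f x :=
      (hc.1 x hx).differentiableAt (ho.mem_nhds hx)
    have hp' := hp.deriv hd
    refine ⟨hl, deriv f, fun x hx => (hd x hx).hasDerivAt, ih hc.2.2 hp' ?_⟩
    obtain ⟨K, hK⟩ := hp'
    exact lipPolyOn_of_piecewise K ho hJ hc.2.2.continuousOn hK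

theorem TemperedOn.of_succ {J : Set ℝ} {m : ℕ} {f : ℝ → ℝ} (h : TemperedOn J (m + 1) f) :
    TemperedOn J m f := by
  induction m generalizing f with
  | zero => exact h.1
  | succ m ih =>
    obtain ⟨hl, f', hd, hf'⟩ := h
    exact ⟨hl, f', hd, ih hf'⟩

theorem TemperedOn.add {J : Set ℝ} {m : ℕ} {f g : ℝ → ℝ} (hf : TemperedOn J m f)
    (hg : TemperedOn J m g) : TemperedOn J m fun x => f x + g x := by
  induction m generalizing f g with
  | zero => exact LipPolyOn.add hf hg
  | succ m ih =>
    obtain ⟨hl, f', hd, hf'⟩ := hf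
    obtain ⟨kl, g', kd, hg'⟩ := hg
    exact ⟨hl.add kl, _, fun x hx => (hd x hx).add (kd x hx), ih hf' hg'⟩

theorem TemperedOn.mul {m : ℕ} {f g : ℝ → ℝ} (hf : TemperedOn univ m f)
    (hg : TemperedOn univ m g) : TemperedOn univ m fun x => f x * g x := by
  induction m generalizing f g with
  | zero => exact LipPolyOn.mul hf hg
  | succ m ih =>
    have hf0 := hf.of_succ
    have hg0 := hg.of_succ
    obtain ⟨hl, f', hd, hf'⟩ := hf
    obtain ⟨kl, g', kd, hg'⟩ := hg
    exact ⟨hl.mul kl, _, fun x hx => (hd x hx).mul (kd x hx), (ih hf' hg0).add (ih hf0 hg')⟩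

/-- The chain rule gives `f'(G) * G'`, whose factors are tempered of one order less by induction and
hypothesis. -/
theorem TemperedOn.comp {J : Set ℝ} {m : ℕ} {f G : ℝ → ℝ} (hf : TemperedOn J m f)
    (hG : TemperedOn univ m G) (hJ : ∀ x, G x ∈ J) : TemperedOn univ m fun x => f (G x) := by
  induction m generalizing f with
  | zero => exact LipPolyOn.comp hf hG hJ
  | succ m ih =>
    have hG0 := hG.of_succ
    obtain ⟨hl, f', hd, hf'⟩ := hf
    obtain ⟨kl, G', kd, hG'⟩ := hG
    exact ⟨hl.comp kl hJ, _, fun x hx => (hd (G x) (hJ x)).comp x (kd x hx),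
      (ih hf' hG0).mul hG'⟩

theorem temperedOn_affine (m : ℕ) (a b : ℝ) : TemperedOn univ m fun x => a + b * x := by
  induction m generalizing a b with
  | zero => exact lipPolyOn_affine univ a b
  | succ m ih =>
    refine ⟨lipPolyOn_affine univ a b, fun x => b + 0 * x, fun x _ => ?_, ih b 0⟩
    simpa using ((hasDerivAt_id x).const_mul b).const_add a

end Closure

/-! ### Gaussian convolution -/

section Convolution
open Filter Topology Set

theorem one_add_abs_sub_le (z x : ℝ) : 1 + |z - x| ≤ (1 + |z|) * (1 + |x|) := by
  have := abs_sub z x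
  nlinarith [mul_nonneg (abs_nonneg z) (abs_nonneg x)]

theorem PolyGrowth.integrable_comp_sub {F : ℝ → ℝ} (hF : PolyGrowth F) (hm : Measurable F)
    (v : ℝ≥0) (z : ℝ) : Integrable (fun x => F (z - x)) (gaussianReal 0 v) := by
  obtain ⟨C, N, hC, h⟩ := hF
  refine PolyGrowth.integrable ⟨C * (1 + |z|) ^ N, N, by positivity, fun x => ?_⟩ v (by fun_prop)
  rw [mul_assoc, ← mul_pow]
  refine (h _).trans ?_
  gcongr
  exact one_add_abs_sub_le z x

/-- A shift by `x` costs a factor polynomial in `|x|` in the local Lipschitz constant, and Gaussian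
moments are finite. -/
theorem LipPolyOn.integral_comp_sub {F : ℝ → ℝ} (hF : LipPolyOn univ F) (v : ℝ≥0) :
    LipPolyOn univ fun z => ∫ x, F (z - x) ∂(gaussianReal 0 v) := by
  have hi := hF.polyGrowth.integrable_comp_sub hF.continuous.measurable v
  obtain ⟨C, N, hC, h⟩ := hF
  have hI : 0 ≤ ∫ x, (2 * (1 + |x|)) ^ N ∂(gaussianReal 0 v) :=
    integral_nonneg fun x => by positivity
  refine ⟨C * ∫ x, (2 * (1 + |x|)) ^ N ∂(gaussianReal 0 v), N, by positivity,
    fun z _ y _ => ?_⟩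
  rw [← integral_sub (hi z) (hi y)]
  have hint : Integrable (fun x : ℝ => (2 * (1 + |x|)) ^ N) (gaussianReal 0 v) := by
    simp only [mul_pow]
    exact (integrable_one_add_abs_pow v N).const_mul _
  calc |∫ x, (F (z - x) - F (y - x)) ∂(gaussianReal 0 v)|
      ≤ ∫ x, C * |z - y| * (1 + |z| + |y|) ^ N * (2 * (1 + |x|)) ^ N ∂(gaussianReal 0 v) := by
        rw [← Real.norm_eq_abs]
        refine norm_integral_le_of_norm_le (hint.const_mul _) (ae_of_all _ fun x => ?_)
        rw [Real.norm_eq_abs, mul_assoc, ← mul_pow]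
        refine (h _ trivial _ trivial).trans ?_
        have h1 : |z - x - (y - x)| = |z - y| := by ring_nf
        rw [h1]
        gcongr
        have := abs_sub z x
        have := abs_sub y x
        nlinarith [mul_nonneg (abs_nonneg z) (abs_nonneg x),
          mul_nonneg (abs_nonneg y) (abs_nonneg x), abs_nonneg x, abs_nonneg z, abs_nonneg y]
    _ = _ := by rw [integral_const_mul]; ring

theorem hasDerivAt_integral_comp_sub {F F' : ℝ → ℝ} (hF : PolyGrowth F) (hF' : PolyGrowth F')
    (hm : Measurable F') (hd : ∀ x, HasDerivAt F (F' x) x) (v : ℝ≥0) (z : ℝ) :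
    HasDerivAt (fun z => ∫ x, F (z - x) ∂(gaussianReal 0 v))
      (∫ x, F' (z - x) ∂(gaussianReal 0 v)) z := by
  have hmF : Measurable F := (continuous_iff_continuousAt.2 fun x => (hd x).continuousAt).measurable
  have hi := hF.integrable_comp_sub hmF v
  obtain ⟨C, N, hC, h⟩ := hF'
  refine (hasDerivAt_integral_of_dominated_loc_of_deriv_le (Metric.ball_mem_nhds z one_pos)
    (F := fun z x => F (z - x)) (F' := fun z x => F' (z - x))
    (bound := fun x => C * (2 + |z|) ^ N * (1 + |x|) ^ N)
    (Eventually.of_forall fun y => (hi y).aestronglyMeasurable) (hi z)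
    (Measurable.aestronglyMeasurable (by fun_prop)) (ae_of_all _ fun x y hy => ?_)
    ((integrable_one_add_abs_pow v N).const_mul _) (ae_of_all _ fun x y _ => ?_)).2
  · rw [mul_assoc, ← mul_pow]
    refine (h _).trans ?_
    gcongr
    refine (one_add_abs_sub_le y x).trans ?_
    have : |y| ≤ |z| + 1 := by
      have h1 := abs_sub_abs_le_abs_sub y z
      rw [mem_ball_iff_norm, Real.norm_eq_abs] at hy
      linarith
    exact mul_le_mul_of_nonneg_right (by linarith) (by positivity)
  · exact (hd (y - x)).comp_sub_const y x

theorem TemperedOn.integral_comp_sub {m : ℕ} {F : ℝ → ℝ} (hF : TemperedOn univ m F) (v : ℝ≥0) :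
    TemperedOn univ m fun z => ∫ x, F (z - x) ∂(gaussianReal 0 v) := by
  induction m generalizing F with
  | zero => exact LipPolyOn.integral_comp_sub hF v
  | succ m ih =>
    obtain ⟨hl, F', hd, hF'⟩ := hF
    exact ⟨hl.integral_comp_sub v, _, fun z _ => hasDerivAt_integral_comp_sub hl.polyGrowth
      hF'.lipPolyOn.polyGrowth hF'.lipPolyOn.continuous.measurable (fun x => hd x trivial) v z,
      ih hF'⟩

theorem heatConv_eq_integral {v : ℝ≥0} (hv : v ≠ 0) (F : ℝ → ℝ) (z : ℝ) :
    heatConv v F z = ∫ x, F (z - x) ∂(gaussianReal 0 v) :=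
  (integral_gaussianReal_eq hv fun x => F (z - x)).symm

theorem integral_gaussianReal_pos {v : ℝ≥0} (hv : v ≠ 0) {f : ℝ → ℝ} (hc : Continuous f)
    (hf : ∀ x, 0 ≤ f x) (hi : Integrable f (gaussianReal 0 v)) {a : ℝ} (ha : f a ≠ 0) :
    0 < ∫ x, f x ∂(gaussianReal 0 v) := by
  refine (integral_nonneg hf).lt_of_ne fun h => ha ?_
  have h1 : f =ᵐ[volume] fun _ => 0 :=
    (gaussianReal_absolutelyContinuous' 0 hv).ae_le ((integral_eq_zero_iff_of_nonneg hf hi).1 h.symm)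
  exact congrFun ((hc.ae_eq_iff_eq volume continuous_const).1 h1) a

/-- A CDF is neither identically 0 nor identically 1, and by continuity it differs from each on a
set of positive Gaussian measure, so both inequalities are strict. -/
theorem IsCDF.heatConv_mem_Ioo {F : ℝ → ℝ} (hF : IsCDF F) (hc : Continuous F) {v : ℝ≥0}
    (hv : v ≠ 0) (z : ℝ) : heatConv v F z ∈ Ioo (0 : ℝ) 1 := by
  obtain ⟨μ, _, h⟩ := hF
  have h0 (x : ℝ) : 0 ≤ F x := by rw [h]; exact cdf_nonneg μ x
  have h1 (x : ℝ) : F x ≤ 1 := by rw [h]; exact cdf_le_one μ x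
  obtain ⟨a, ha⟩ : ∃ a, F a ≠ 0 := by
    obtain ⟨a, ha⟩ := ((tendsto_cdf_atTop μ).eventually_const_lt one_pos).exists
    exact ⟨a, by rw [h]; exact ha.ne'⟩
  obtain ⟨b, hb⟩ : ∃ b, F b ≠ 1 := by
    obtain ⟨b, hb⟩ := ((tendsto_cdf_atBot μ).eventually_lt_const one_pos).exists
    exact ⟨b, by rw [h]; exact hb.ne⟩
  have hpg : PolyGrowth F := ⟨1, 0, zero_le_one, fun x => by
    rw [abs_of_nonneg (h0 x)]; simpa using h1 x⟩
  have hi := hpg.integrable_comp_sub hc.measurable v z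
  have hcz : Continuous fun x => F (z - x) := by fun_prop
  rw [heatConv_eq_integral hv]
  refine ⟨integral_gaussianReal_pos hv hcz (fun x => h0 _) hi (a := z - a) (by simpa using ha), ?_⟩
  have := integral_gaussianReal_pos hv (f := fun x => 1 - F (z - x)) (by fun_prop)
    (fun x => sub_nonneg.2 (h1 _)) ((integrable_const 1).sub hi) (a := z - b)
    (by simpa [sub_eq_zero] using hb.symm)
  rw [integral_sub (integrable_const 1) hi] at this
  simpa using this

end Convolution

/-! ### Weak derivatives and rescaling to variance `v` -/

section Sobolev
open Set

theorem iteratedDeriv_test {φ : ℝ → ℝ} (hφ : ContDiff ℝ ∞ φ) (hs : HasCompactSupport φ) (k : ℕ) :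
    ContDiff ℝ ∞ (iteratedDeriv k φ) ∧ HasCompactSupport (iteratedDeriv k φ) := by
  induction k generalizing φ with
  | zero => simpa using ⟨hφ, hs⟩
  | succ k ih =>
    rw [iteratedDeriv_succ']
    exact ih (contDiff_infty_iff_deriv.1 hφ).2 hs.deriv

theorem integral_mul_deriv_of_hasCompactSupport {g g' φ : ℝ → ℝ} (hc : Continuous g')
    (hd : ∀ x, HasDerivAt g (g' x) x) (hφ : ContDiff ℝ ∞ φ) (hs : HasCompactSupport φ) :
    ∫ x, g x * deriv φ x = -∫ x, g' x * φ x := by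
  have hg : Continuous g := continuous_iff_continuousAt.2 fun x => (hd x).continuousAt
  have hφ' := contDiff_infty_iff_deriv.1 hφ
  exact integral_mul_deriv_eq_deriv_mul_of_integrable (fun x _ => hd x)
    (fun x _ => (hφ'.1 x).hasDerivAt)
    ((hg.mul hφ'.2.continuous).integrable_of_hasCompactSupport hs.deriv.mul_left)
    ((hc.mul hφ.continuous).integrable_of_hasCompactSupport hs.mul_left)
    ((hg.mul hφ.continuous).integrable_of_hasCompactSupport hs.mul_left)

/-- Classical derivatives are weak derivatives, by integrating by parts against a compactly
supported test function, one order at a time. -/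
theorem TemperedOn.exists_hasWeakDeriv {k : ℕ} {g : ℝ → ℝ} (hg : TemperedOn univ k g) :
    ∃ u, LipPolyOn univ u ∧ HasWeakDeriv k g u := by
  induction k generalizing g with
  | zero =>
    have hc := (LipPolyOn.continuous hg).locallyIntegrable (μ := volume)
    exact ⟨g, hg, hc, hc, fun φ _ _ => by simp⟩
  | succ k ih =>
    obtain ⟨hl, g', hd, hg'⟩ := hg
    obtain ⟨u, hu, -, hui, h⟩ := ih hg'
    refine ⟨u, hu, hl.continuous.locallyIntegrable, hui, fun φ hφ hs => ?_⟩
    obtain ⟨h1, h2⟩ := iteratedDeriv_test hφ hs k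
    rw [iteratedDeriv_succ, integral_mul_deriv_of_hasCompactSupport hg'.lipPolyOn.continuous
      (fun x => hd x trivial) h1 h2, h φ hφ hs, pow_succ]
    ring

theorem TemperedOn.of_le {J : Set ℝ} {m k : ℕ} {f : ℝ → ℝ} (h : TemperedOn J m f) (hk : k ≤ m) :
    TemperedOn J k f := by
  induction m, hk using Nat.le_induction with
  | base => exact h
  | succ m _ ih => exact ih h.of_succ

theorem TemperedOn.memGaussianSobolev {m : ℕ} {g : ℝ → ℝ} (hg : TemperedOn univ m g) (v : ℝ≥0) :
    MemGaussianSobolev m v g := by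
  refine ⟨hg.lipPolyOn.polyGrowth.memLp v hg.lipPolyOn.continuous.measurable, fun k _ hk => ?_⟩
  obtain ⟨u, hu, h⟩ := (hg.of_le hk).exists_hasWeakDeriv
  exact ⟨u, h, hu.polyGrowth.memLp v hu.continuous.measurable⟩

theorem gaussHermite_eq_gaussHermite_one (n : ℕ) (v : ℝ≥0) (f : ℝ → ℝ) :
    gaussHermite n v f = gaussHermite n 1 fun x => f (√(v : ℝ) * x) := by
  simp [gaussHermite]

theorem integral_gaussianReal_eq_integral_one (v : ℝ≥0) {f : ℝ → ℝ} (hf : Continuous f) :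
    ∫ x, f x ∂(gaussianReal 0 v) = ∫ x, f (√(v : ℝ) * x) ∂(gaussianReal 0 1) := by
  have h := gaussianReal_map_const_mul (μ := 0) (v := 1) (√(v : ℝ))
  have hv : NNReal.mk (√(v : ℝ) ^ 2) (sq_nonneg _) * 1 = v := by
    ext; simp
  rw [mul_zero, hv] at h
  rw [← h, integral_map (by fun_prop) hf.aestronglyMeasurable]

theorem TemperedOn.gaussHermite_sub_integral_isBigO {m : ℕ} {g : ℝ → ℝ}
    (hg : TemperedOn univ m g) (v : ℝ≥0) :
    (fun n : ℕ => gaussHermite n v g - ∫ x, g x ∂(gaussianReal 0 v))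
      =O[Filter.atTop] fun n : ℕ => (n : ℝ) ^ (-(m : ℝ) / 2) := by
  have h : TemperedOn univ m fun x => g (√(v : ℝ) * x) := by
    simpa using hg.comp (temperedOn_affine m 0 √(v : ℝ)) fun _ => mem_univ _
  simp only [gaussHermite_eq_gaussHermite_one _ v,
    integral_gaussianReal_eq_integral_one v hg.lipPolyOn.continuous]
  exact h.gaussHermite_sub_isBigO

theorem TemperedOn.comp_const_sub {m : ℕ} {g : ℝ → ℝ} (hg : TemperedOn univ m g) (w : ℝ) :
    TemperedOn univ m fun x => g (w - x) := by
  simpa [sub_eq_add_neg] using hg.comp (temperedOn_affine m w (-1)) fun _ => mem_univ _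

end Sobolev

/-! ### The two integrals of the fixed-point scheme -/

theorem mainTheorem1 (m : ℕ) (T₀ T₁ : ℝ) (hT : T₀ < T₁) (v : ℝ≥0) (hv : (v : ℝ) = T₁ - T₀)
    -- `F` is the iterate; `Finv`, on its domain `J`, is the inverse of the marginal CDF at `T₁`
    (F Finv : ℝ → ℝ) (J : Set ℝ)
    -- the inverse CDF is given on the whole line (extrapolated), or on `(0, 1)` for a CDF `F`
    (hJ : J = Set.univ ∨ (J = Set.Ioo 0 1 ∧ IsCDF F))
    (hF : IsSplineOn m F Set.univ) (hFinv : IsSplineOn m Finv J) :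
    -- the inner integrands
    (∀ w y : ℝ,
      MemGaussianSobolev m v (fun x => F (w - y - x)) ∧
      (fun n : ℕ => gaussHermite n v (fun x => F (w - y - x)) - heatConv v F (w - y))
        =O[Filter.atTop] fun n : ℕ => (n : ℝ) ^ (-(m : ℝ) / 2)) ∧
    -- the outer integrands are well defined
    (∀ z : ℝ, heatConv v F z ∈ J) ∧
    -- the outer integrands
    (∀ w : ℝ,
      MemGaussianSobolev m v (fun y => Finv (heatConv v F (w - y))) ∧
      (fun n : ℕ => gaussHermite n v (fun y => Finv (heatConv v F (w - y)))
          - heatConv v (fun z => Finv (heatConv v F z)) w)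
        =O[Filter.atTop] fun n : ℕ => (n : ℝ) ^ (-(m : ℝ) / 2)) := by
  have hv0 : v ≠ 0 := by
    rintro rfl
    rw [NNReal.coe_zero] at hv
    linarith
  have hFt : TemperedOn Set.univ m F := hF.temperedOn isOpen_univ Set.ordConnected_univ
  have hGt : TemperedOn Set.univ m (heatConv v F) := by
    have h := hFt.integral_comp_sub v
    simp only [← heatConv_eq_integral hv0] at h
    exact h
  have hGJ (z : ℝ) : heatConv v F z ∈ J := by
    rcases hJ with rfl | ⟨rfl, hcdf⟩
    · exact Set.mem_univ _
    · exact hcdf.heatConv_mem_Ioo hFt.lipPolyOn.continuous hv0 z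
  have hFinvt : TemperedOn J m Finv := by
    rcases hJ with rfl | ⟨rfl, -⟩
    · exact hFinv.temperedOn isOpen_univ Set.ordConnected_univ
    · exact hFinv.temperedOn isOpen_Ioo Set.ordConnected_Ioo
  -- Both claims are one statement about a tempered `g`: take `g = F` at the point `w - y`, or `g =
  -- Finv ∘ heatConv v F` at `w`.
  have key {g : ℝ → ℝ} (hg : TemperedOn Set.univ m g) (w : ℝ) :
      MemGaussianSobolev m v (fun x => g (w - x)) ∧
      (fun n : ℕ => gaussHermite n v (fun x => g (w - x)) - heatConv v g w)
        =O[Filter.atTop] fun n : ℕ => (n : ℝ) ^ (-(m : ℝ) / 2) := by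
    have h := hg.comp_const_sub w
    rw [heatConv_eq_integral hv0]
    exact ⟨h.memGaussianSobolev v, h.gaussHermite_sub_integral_isBigO v⟩
  exact ⟨fun w y => key hFt (w - y), hGJ, fun w => key (hFinvt.comp hGt hGJ) w⟩
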